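/- Let $\Omega\subseteq\mathbb{R}^n$ be convex, open and bounded. For a continuous function $u:\mathbb{R}^n\to\mathbb{R}$ let $\partial^-u(x)=\{p\in\mathbb{R}^n:\ p\cdot(y-x)+u(x)\le u(y)\text{ for all }y\in\mathbb{R}^n\}$ be its subdifferential, $\partial^-u(A)=\bigcup_{x\in A}\partial^-u(x)$, and let $\mu_u$ be its Monge–Ampère measure, the Borel measure given by $\mu_u(A)=\mathcal{L}^n(\partial^-u(A))$ for Borel sets $A\subseteq\mathbb{R}^n$. Let $u,v\in C^0(\mathbb{R}^n)$ be convex functions with $u=v$ in $\mathbb{R}^n\setminus\Omega$. Then (i) $\partial^-u(\overline\Omega)=\partial^-v(\overline\Omega)$; in particular, $\mu_u(\overline\Omega)=\mu_v(\overline\Omega)<\infty$. (ii) The function $x\mapsto x$ is integrable over $\overline\Omega$ with respect to $\mu_u$ and $\mu_v$, and $\int_{\overline\Omega}x\,\mathrm{d}\mu_u=\int_{\overline\Omega}x\,\mathrm{d}\mu_v$. Moreover, the first moment of $\det\nabla^2u$ is a null Lagrangian, also for functions that are not convex: for all $u\in W^{2,\infty}(\Omega)$, all $w\in W^{2,\infty}_0(\Omega)$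 and all $t\in\mathbb{R}$, the function $x\mapsto x\det\nabla^2(u+tw)(x)$ is integrable over $\Omega$ and $$\int_\Omega x\,\det\nabla^2(u+tw)\,\mathrm{d}x=\int_\Omega x\,\det\nabla^2u\,\mathrm{d}x,\qquad\text{and so}\qquad \left.\frac{\mathrm{d}}{\mathrm{d}t}\right|_{t=0}\int_\Omega x\,\det\nabla^2(u+tw)\,\mathrm{d}x=0.$$ Here $\nabla^2$ denotes the weak Hessian, and $W^{2,\infty}_0(\Omega)$ is the set of functions in $W^{2,\infty}(\mathbb{R}^n)$ that vanish a.e. outside $\Omega$. -/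

import Mathlib

open MeasureTheory Set
open scoped RealInnerProductSpace ContDiff

/-- The subdifferential at `x` of a function `u` defined on all of `ℝⁿ`. -/
def subgradient {n : ℕ} (u : EuclideanSpace ℝ (Fin n) → ℝ) (x : EuclideanSpace ℝ (Fin n)) :
    Set (EuclideanSpace ℝ (Fin n)) :=
  {p | ∀ y, ⟪p, y - x⟫ + u x ≤ u y}

/-- The image of a set `A` under the subgradient map, i.e. the union of the subdifferentials
at the points of `A`. -/
def subgradientImage {n : ℕ} (u : EuclideanSpace ℝ (Fin n) → ℝ)
    (A : Set (EuclideanSpace ℝ (Fin n))) : Set (EuclideanSpace ℝ (Fin n)) :=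
  ⋃ x ∈ A, subgradient u x

/-- The set function assigning to `A` the Lebesgue (outer) measure of the subgradient image
of `A`, as an outer measure. -/
noncomputable def mongeAmpereOuter {n : ℕ} (u : EuclideanSpace ℝ (Fin n) → ℝ) :
    OuterMeasure (EuclideanSpace ℝ (Fin n)) where
  measureOf A := volume (subgradientImage u A)
  empty := by simp [subgradientImage]
  mono {A B} h := measure_mono (biUnion_subset_biUnion_left h)
  iUnion_nat A _ := by
    have h : subgradientImage u (⋃ i, A i) = ⋃ i, subgradientImage u (A i) := by
      ext p
      simp only [subgradientImage, mem_iUnion, exists_prop]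
      constructor
      · rintro ⟨x, ⟨i, hi⟩, hp⟩
        exact ⟨i, x, hi, hp⟩
      · rintro ⟨i, x, hi, hp⟩
        exact ⟨x, ⟨i, hi⟩, hp⟩
    rw [h]
    exact measure_iUnion_le _

/-- Almost every vector is a subgradient at no more than one point. -/
theorem volume_subgradient_overlap {n : ℕ} {u : EuclideanSpace ℝ (Fin n) → ℝ}
    (hu : Continuous u) :
    volume {p | ∃ x y, x ≠ y ∧ p ∈ subgradient u x ∧ p ∈ subgradient u y} = 0 := by
  classical
  have key : ∀ R : ℕ, ∀ᵐ p : EuclideanSpace ℝ (Fin n), ∀ x y, ‖x‖ ≤ R → ‖y‖ ≤ R →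
      p ∈ subgradient u x → p ∈ subgradient u y → x = y := by
    intro R
    set B : Set (EuclideanSpace ℝ (Fin n)) := Metric.closedBall 0 R with hB
    let f : EuclideanSpace ℝ (Fin n) → ℝ := fun p => sSup ((fun x => ⟪p, x⟫ - u x) '' B)
    have hbdd : ∀ p, BddAbove ((fun x => ⟪p, x⟫ - u x) '' B) := fun p =>
      ((isCompact_closedBall _ _).image (by fun_prop)).bddAbove
    have hne : B.Nonempty := ⟨0, by simp [hB]⟩
    have hlip : LipschitzWith (R : NNReal) f := by
      apply LipschitzWith.of_le_add_mul
      intro p q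
      apply csSup_le (hne.image _)
      rintro _ ⟨x, hx, rfl⟩
      have h1 : ⟪q, x⟫ - u x ≤ f q := le_csSup (hbdd q) ⟨x, hx, rfl⟩
      have h2 : ⟪p - q, x⟫ ≤ ‖p - q‖ * ‖x‖ := real_inner_le_norm _ _
      have h3 : ‖x‖ ≤ R := by simpa [hB] using hx
      have h4 : ‖p - q‖ * ‖x‖ ≤ R * dist p q := by
        rw [dist_eq_norm, mul_comm]
        gcongr
      rw [inner_sub_left] at h2
      simp only [NNReal.coe_natCast]
      linarith
    filter_upwards [hlip.ae_differentiableAt] with p hp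
    have grad : ∀ x, ‖x‖ ≤ R → p ∈ subgradient u x → fderiv ℝ f p = innerSL ℝ x := by
      intro x hx hpx
      have hxB : x ∈ B := by simpa [hB] using hx
      have hfp : f p = ⟪p, x⟫ - u x := by
        apply le_antisymm
        · apply csSup_le (hne.image _)
          rintro _ ⟨y, -, rfl⟩
          have := hpx y
          rw [inner_sub_right] at this
          dsimp only
          linarith
        · exact le_csSup (hbdd p) ⟨x, hxB, rfl⟩
      have hmin : IsLocalMin (fun q => f q - innerSL ℝ x q) p := by
        refine Filter.Eventually.of_forall fun q => ?_
        have h1 : ⟪q, x⟫ - u x ≤ f q := le_csSup (hbdd q) ⟨x, hxB, rfl⟩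
        simp only [innerSL_apply_apply]
        rw [hfp, real_inner_comm p x, real_inner_comm q x]
        linarith
      have h0 := hmin.hasFDerivAt_eq_zero
        (hp.hasFDerivAt.sub (innerSL ℝ x).hasFDerivAt)
      exact sub_eq_zero.mp h0
    intro x y hx hy hpx hpy
    have h := (grad x hx hpx).symm.trans (grad y hy hpy)
    refine ext_inner_right ℝ fun v => ?_
    simpa using congrArg (fun L => L v) h
  have hall := ae_all_iff.mpr key
  rw [ae_iff] at hall
  refine measure_mono_null ?_ hall
  rintro p ⟨x, y, hxy, hpx, hpy⟩ hcon
  obtain ⟨R, hR⟩ := exists_nat_ge (max ‖x‖ ‖y‖)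
  exact hxy (hcon R x y ((le_max_left _ _).trans hR) ((le_max_right _ _).trans hR) hpx hpy)

/-- The subgradient image of a compact set is closed. -/
theorem isClosed_subgradientImage {n : ℕ} {u : EuclideanSpace ℝ (Fin n) → ℝ}
    (hu : Continuous u) {K : Set (EuclideanSpace ℝ (Fin n))} (hK : IsCompact K) :
    IsClosed (subgradientImage u K) := by
  apply IsSeqClosed.isClosed
  intro p q hp hq
  have h : ∀ k, ∃ x ∈ K, p k ∈ subgradient u x := fun k => by
    simpa [subgradientImage] using hp k
  choose x hxK hpx using h
  obtain ⟨a, haK, φ, hφ, hlim⟩ := hK.tendsto_subseq hxK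
  have hpq := hq.comp hφ.tendsto_atTop
  have : q ∈ subgradient u a := by
    intro y
    have hl : Filter.Tendsto (fun k => ⟪p (φ k), y - x (φ k)⟫ + u (x (φ k))) Filter.atTop
        (nhds (⟪q, y - a⟫ + u a)) :=
      (hpq.inner (tendsto_const_nhds.sub hlim)).add ((hu.tendsto a).comp hlim)
    exact le_of_tendsto hl (Filter.Eventually.of_forall fun k => hpx (φ k) y)
  simp only [subgradientImage, mem_iUnion, exists_prop]
  exact ⟨a, haK, this⟩

/-- The subgradient image of a closed set is Borel. -/
theorem measurableSet_subgradientImage {n : ℕ} {u : EuclideanSpace ℝ (Fin n) → ℝ}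
    (hu : Continuous u) {F : Set (EuclideanSpace ℝ (Fin n))} (hF : IsClosed F) :
    MeasurableSet (subgradientImage u F) := by
  have h : subgradientImage u F =
      ⋃ R : ℕ, subgradientImage u (F ∩ Metric.closedBall 0 R) := by
    ext p
    simp only [subgradientImage, mem_iUnion, exists_prop, mem_inter_iff,
      mem_closedBall_zero_iff]
    constructor
    · rintro ⟨x, hx, hp⟩
      obtain ⟨R, hR⟩ := exists_nat_ge ‖x‖
      exact ⟨R, x, ⟨hx, hR⟩, hp⟩
    · rintro ⟨R, x, ⟨hx, -⟩, hp⟩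
      exact ⟨x, hx, hp⟩
  rw [h]
  exact MeasurableSet.iUnion fun R =>
    (isClosed_subgradientImage hu ((isCompact_closedBall 0 (R : ℝ)).inter_left hF)).measurableSet

/-- The set function is countably additive on Borel sets. -/
theorem le_caratheodory_mongeAmpereOuter {n : ℕ} {u : EuclideanSpace ℝ (Fin n) → ℝ}
    (hu : Continuous u) :
    (inferInstance : MeasurableSpace (EuclideanSpace ℝ (Fin n))) ≤
      (mongeAmpereOuter u).caratheodory := by
  rw [BorelSpace.measurable_eq (α := EuclideanSpace ℝ (Fin n)), borel_eq_generateFrom_isClosed]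
  apply MeasurableSpace.generateFrom_le
  intro F hF
  rw [OuterMeasure.isCaratheodory_iff_le]
  intro A
  change volume (subgradientImage u (A ∩ F)) + volume (subgradientImage u (A \ F)) ≤
    volume (subgradientImage u A)
  rw [← measure_inter_add_sdiff (subgradientImage u A) (measurableSet_subgradientImage hu hF)]
  have h1 : subgradientImage u (A ∩ F) ⊆ subgradientImage u A ∩ subgradientImage u F :=
    subset_inter (biUnion_subset_biUnion_left inter_subset_left)
      (biUnion_subset_biUnion_left inter_subset_right)
  have h2 : subgradientImage u (A \ F) ⊆ (subgradientImage u A \ subgradientImage u F) ∪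
      {p | ∃ x y, x ≠ y ∧ p ∈ subgradient u x ∧ p ∈ subgradient u y} := by
    intro p hp
    by_cases hpF : p ∈ subgradientImage u F
    · right
      simp only [subgradientImage, mem_iUnion, exists_prop] at hp hpF
      obtain ⟨x, hx, hpx⟩ := hp
      obtain ⟨y, hy, hpy⟩ := hpF
      exact ⟨x, y, fun h => hx.2 (h ▸ hy), hpx, hpy⟩
    · exact Or.inl ⟨biUnion_subset_biUnion_left sdiff_subset hp, hpF⟩
  refine add_le_add (measure_mono h1) ((measure_mono h2).trans ((measure_union_le _ _).trans ?_))
  rw [volume_subgradient_overlap hu, add_zero]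

/-- The Monge-Ampère measure `μ_u` of a continuous function `u` on `ℝⁿ`. -/
noncomputable def mongeAmpere {n : ℕ} (u : EuclideanSpace ℝ (Fin n) → ℝ) (hu : Continuous u) :
    Measure (EuclideanSpace ℝ (Fin n)) :=
  (mongeAmpereOuter u).toMeasure (le_caratheodory_mongeAmpereOuter hu)

/-- `μ_u(A)` is the Lebesgue measure of the subgradient image of the Borel set `A`. -/
theorem mongeAmpere_apply {n : ℕ} {u : EuclideanSpace ℝ (Fin n) → ℝ} (hu : Continuous u)
    {A : Set (EuclideanSpace ℝ (Fin n))} (hA : MeasurableSet A) :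
    mongeAmpere u hu A = volume (subgradientImage u A) :=
  toMeasure_apply _ _ hA

/-- `g` is the weak partial derivative `∂ᵢ f` on the open set `U`. -/
def HasWeakPartialOn {n : ℕ} (U : Set (EuclideanSpace ℝ (Fin n))) (i : Fin n)
    (f g : EuclideanSpace ℝ (Fin n) → ℝ) : Prop :=
  LocallyIntegrableOn f U ∧ LocallyIntegrableOn g U ∧
    ∀ φ : EuclideanSpace ℝ (Fin n) → ℝ, ContDiff ℝ ∞ φ → HasCompactSupport φ → tsupport φ ⊆ U →
      ∫ x in U, f x * fderiv ℝ φ x (EuclideanSpace.single i 1) = -∫ x in U, g x * φ x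

/-- `u` belongs to the Sobolev space `W^{2,∞}(U)` and `H` is its weak Hessian `∇²u` on `U`. -/
def IsW2InftyOn {n : ℕ} (U : Set (EuclideanSpace ℝ (Fin n)))
    (u : EuclideanSpace ℝ (Fin n) → ℝ)
    (H : EuclideanSpace ℝ (Fin n) → Matrix (Fin n) (Fin n) ℝ) : Prop :=
  MemLp u ⊤ (volume.restrict U) ∧
    ∃ G : Fin n → EuclideanSpace ℝ (Fin n) → ℝ,
      (∀ i, MemLp (G i) ⊤ (volume.restrict U) ∧ HasWeakPartialOn U i u (G i)) ∧
      ∀ i j, MemLp (fun x => H x i j) ⊤ (volume.restrict U) ∧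
        HasWeakPartialOn U j (G i) (fun x => H x i j)

/-- `w` belongs to `W^{2,∞}_0(U)` and `H` is its weak Hessian: `w` is a `W^{2,∞}` function on all
of `ℝⁿ` that vanishes outside `U` (so `w` and `∇w` vanish on the boundary of `U`). -/
def IsW2InftyZeroOn {n : ℕ} (U : Set (EuclideanSpace ℝ (Fin n)))
    (w : EuclideanSpace ℝ (Fin n) → ℝ)
    (H : EuclideanSpace ℝ (Fin n) → Matrix (Fin n) (Fin n) ℝ) : Prop :=
  IsW2InftyOn univ w H ∧ ∀ᵐ x, x ∉ U → w x = 0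

/-! For a subgradient p, work with the tilted function u - ⟨p, ·⟩. A minimiser of v - ⟨p, ·⟩ over
the compact closure of Ω turns out to be a global one whenever u - ⟨p, ·⟩ attains its global minimum
in that closure. This gives the equality P of the two subgradient images.

For the first moments, let f and g be the Legendre transforms of u and v restricted to the closure
of Ω. They are Lipschitz, and at almost every p in P the gradient of f is the point having p as a
subgradient. Hence ∇f pushes Lebesgue measure on P forward to the Monge–Ampère measure, and the
moment of u is ∫_P ∇f (`setIntegral_id_mongeAmpere`). Off P the maximisers lie on the boundary of Ω,
where u = v, so f = g there. Thus f - g has compact support and its gradient integrates to zero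
(`setIntegral_id_mongeAmpere_eq`).

For the null Lagrangian, smooth compactly supported functions become convex after adding C|x|²/2
with C large, and then the Monge–Ampère density is det(∇² + C I). The convex result gives the
identity for all large C; both sides are polynomials in C, so interpolation recovers C = 0
(`setIntegral_det_hessian_add`). The W^{2,∞} case follows by mollification. Since u lives only on Ω,
its mollification is composed with a homothety contracting Ω into itself, and dominated convergence
passes to the limit. -/

/-! ### Subgradient images of convex functions agreeing off Ω. -/

theorem mem_subgradient_iff {n : ℕ} {u : EuclideanSpace ℝ (Fin n) → ℝ}
    {x p : EuclideanSpace ℝ (Fin n)} :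
    p ∈ subgradient u x ↔ ∀ y, u x - ⟪p, x⟫ ≤ u y - ⟪p, y⟫ := by
  refine forall_congr' fun y => ?_
  rw [inner_sub_right]
  constructor <;> intro h <;> linarith

theorem mem_subgradientImage {n : ℕ} {u : EuclideanSpace ℝ (Fin n) → ℝ}
    {A : Set (EuclideanSpace ℝ (Fin n))} {p : EuclideanSpace ℝ (Fin n)} :
    p ∈ subgradientImage u A ↔ ∃ x ∈ A, p ∈ subgradient u x := by
  simp [subgradientImage]

theorem ConvexOn.sub_inner {n : ℕ} {u : EuclideanSpace ℝ (Fin n) → ℝ}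
    (hu : ConvexOn ℝ univ u) (p : EuclideanSpace ℝ (Fin n)) :
    ConvexOn ℝ univ (fun y => u y - ⟪p, y⟫) :=
  hu.sub ((innerSL ℝ p).toLinearMap.concaveOn convex_univ)

/-- Changing a convex function inside a bounded open set does not destroy subgradients at points
of its closure. -/
theorem subgradientImage_closure_subset {n : ℕ} {Ω : Set (EuclideanSpace ℝ (Fin n))}
    (hopen : IsOpen Ω) (hbdd : Bornology.IsBounded Ω) {u v : EuclideanSpace ℝ (Fin n) → ℝ}
    (hv : Continuous v) (huc : ConvexOn ℝ univ u) (huv : ∀ x, x ∉ Ω → u x = v x) :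
    subgradientImage u (closure Ω) ⊆ subgradientImage v (closure Ω) := by
  intro p hp
  obtain ⟨x, hx, hpx⟩ := mem_subgradientImage.1 hp
  rw [mem_subgradient_iff] at hpx
  obtain ⟨x₀, hx₀, hmin⟩ := hbdd.isCompact_closure.exists_isMinOn ⟨x, hx⟩
    (f := fun y => v y - ⟪p, y⟫) (by fun_prop)
  replace hmin : ∀ y ∈ closure Ω, v x₀ - ⟪p, x₀⟫ ≤ v y - ⟪p, y⟫ := fun y hy => hmin hy
  refine mem_subgradientImage.2 ⟨x₀, hx₀, mem_subgradient_iff.2 fun y => ?_⟩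
  by_cases hy : y ∈ closure Ω
  · exact hmin y hy
  have hyΩ : y ∉ Ω := fun h => hy (subset_closure h)
  rw [← huv y hyΩ]
  rcases le_or_gt (v x₀ - ⟪p, x₀⟫) (u x - ⟪p, x⟫) with h | h
  · exact h.trans (hpx y)
  have hxΩ : x ∈ Ω := by
    by_contra hxΩ
    have := hmin x hx
    rw [← huv x hxΩ] at this
    linarith
  -- By connectedness, the segment from x in Ω to y outside the closure meets the boundary of Ω,
  -- where u = v.
  obtain ⟨z, hz, hzf, hzΩ⟩ : ∃ z ∈ segment ℝ x y, z ∈ closure Ω ∧ z ∉ Ω := by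
    by_contra! hcon
    obtain ⟨z, -, hz1, hz2⟩ := (convex_segment (𝕜 := ℝ) x y).isPreconnected Ω (closure Ω)ᶜ hopen
      isClosed_closure.isOpen_compl (fun z hz => (em (z ∈ closure Ω)).imp (hcon z hz) id)
      ⟨x, left_mem_segment ℝ x y, hxΩ⟩ ⟨y, right_mem_segment ℝ x y, hy⟩
    exact hz2 (subset_closure hz1)
  have h1 := hmin z hzf
  rw [← huv z hzΩ] at h1
  -- The tilted u is strictly larger at z than at x, so by convexity its value at y is at least that
  -- at z.
  have h2 := (huc.sub_inner p).le_max_of_mem_segment (mem_univ x) (mem_univ y) hz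
  rcases le_max_iff.1 h2 with h3 | h3 <;> linarith

theorem subgradientImage_closure_eq {n : ℕ} {Ω : Set (EuclideanSpace ℝ (Fin n))}
    (hopen : IsOpen Ω) (hbdd : Bornology.IsBounded Ω) {u v : EuclideanSpace ℝ (Fin n) → ℝ}
    (hu : Continuous u) (hv : Continuous v) (huc : ConvexOn ℝ univ u) (hvc : ConvexOn ℝ univ v)
    (huv : ∀ x, x ∉ Ω → u x = v x) :
    subgradientImage u (closure Ω) = subgradientImage v (closure Ω) :=
  (subgradientImage_closure_subset hopen hbdd hv huc huv).antisymm
    (subgradientImage_closure_subset hopen hbdd hu hvc fun x hx => (huv x hx).symm)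

/-- The subgradient image of a compact set is bounded. -/
theorem isBounded_subgradientImage {n : ℕ} {u : EuclideanSpace ℝ (Fin n) → ℝ}
    (hu : Continuous u) {K : Set (EuclideanSpace ℝ (Fin n))} (hK : IsCompact K) :
    Bornology.IsBounded (subgradientImage u K) := by
  obtain ⟨C, hC⟩ := (hK.cthickening (r := 1)).exists_bound_of_continuousOn hu.continuousOn
  refine (Metric.isBounded_closedBall (x := 0) (r := 2 * C)).subset fun p hp => ?_
  obtain ⟨x, hx, hpx⟩ := mem_subgradientImage.1 hp
  rw [mem_closedBall_zero_iff]
  have hx1 := hC x (Metric.self_subset_cthickening _ hx)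
  by_cases h0 : p = 0
  · subst h0
    rw [norm_zero]
    linarith [norm_nonneg (u x)]
  have hp0 : ‖p‖ ≠ 0 := norm_ne_zero_iff.2 h0
  -- Testing the subgradient inequality one unit along p gives ‖p‖ ≤ u(x + p/‖p‖) - u(x) ≤ 2C.
  have hy : x + ‖p‖⁻¹ • p ∈ Metric.cthickening 1 K := by
    apply Metric.mem_cthickening_of_dist_le _ x _ _ hx
    rw [dist_eq_norm, add_sub_cancel_left, norm_smul, norm_inv, norm_norm, inv_mul_cancel₀ hp0]
  have h := hpx (x + ‖p‖⁻¹ • p)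
  rw [add_sub_cancel_left, inner_smul_right, real_inner_self_eq_norm_sq, sq,
    inv_mul_cancel_left₀ hp0] at h
  have h1 := hC _ hy
  rw [Real.norm_eq_abs] at h1 hx1
  linarith [abs_le.1 h1, abs_le.1 hx1]

/-! ### Legendre transforms and the first moment of the Monge–Ampère measure. -/

/-- The Legendre transform of the restriction of `u` to `K`. -/
noncomputable def legendreOn {n : ℕ} (u : EuclideanSpace ℝ (Fin n) → ℝ)
    (K : Set (EuclideanSpace ℝ (Fin n))) (p : EuclideanSpace ℝ (Fin n)) : ℝ :=
  sSup ((fun x => ⟪p, x⟫ - u x) '' K)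

section Legendre

variable {n : ℕ} {u : EuclideanSpace ℝ (Fin n) → ℝ} {K : Set (EuclideanSpace ℝ (Fin n))}

theorem le_legendreOn (hu : Continuous u) (hK : IsCompact K) {x : EuclideanSpace ℝ (Fin n)}
    (hx : x ∈ K) (p : EuclideanSpace ℝ (Fin n)) : ⟪p, x⟫ - u x ≤ legendreOn u K p :=
  le_csSup (hK.image (by fun_prop)).bddAbove ⟨x, hx, rfl⟩

theorem exists_legendreOn_eq (hu : Continuous u) (hK : IsCompact K) (hne : K.Nonempty)
    (p : EuclideanSpace ℝ (Fin n)) :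
    ∃ x ∈ K, legendreOn u K p = ⟪p, x⟫ - u x ∧ ∀ y ∈ K, u x - ⟪p, x⟫ ≤ u y - ⟪p, y⟫ := by
  obtain ⟨x, hx, hmax⟩ := hK.exists_isMinOn hne (f := fun y => u y - ⟪p, y⟫) (by fun_prop)
  replace hmax : ∀ y ∈ K, u x - ⟪p, x⟫ ≤ u y - ⟪p, y⟫ := fun y hy => hmax hy
  refine ⟨x, hx, le_antisymm (csSup_le (hne.image _) ?_) (le_legendreOn hu hK hx p), hmax⟩
  rintro _ ⟨y, hy, rfl⟩
  have := hmax y hy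
  dsimp only
  linarith

theorem exists_lipschitzWith_legendreOn (hu : Continuous u) (hK : IsCompact K)
    (hne : K.Nonempty) : ∃ C, LipschitzWith C (legendreOn u K) := by
  obtain ⟨R, hR⟩ := hK.isBounded.exists_norm_le
  refine ⟨R.toNNReal, LipschitzWith.of_le_add_mul _ fun p q => ?_⟩
  apply csSup_le (hne.image _)
  rintro _ ⟨x, hx, rfl⟩
  have h1 := le_legendreOn hu hK hx q
  have h2 : ⟪p - q, x⟫ ≤ ‖p - q‖ * ‖x‖ := real_inner_le_norm _ _
  have h4 : ‖p - q‖ * ‖x‖ ≤ R.toNNReal * dist p q := by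
    rw [dist_eq_norm, mul_comm]
    gcongr
    exact (hR x hx).trans (Real.le_coe_toNNReal R)
  rw [inner_sub_left] at h2
  dsimp only
  linarith

/-- The affine function q ↦ ⟨q, x⟩ - u(x) lies below the transform and touches it at p, so the two
have the same derivative there. -/
theorem fderiv_legendreOn (hu : Continuous u) (hK : IsCompact K)
    {p x : EuclideanSpace ℝ (Fin n)} (hp : DifferentiableAt ℝ (legendreOn u K) p) (hx : x ∈ K)
    (hpx : p ∈ subgradient u x) : fderiv ℝ (legendreOn u K) p = innerSL ℝ x := by
  have hfp : legendreOn u K p ≤ ⟪p, x⟫ - u x := by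
    apply csSup_le (Nonempty.image _ ⟨x, hx⟩)
    rintro _ ⟨y, -, rfl⟩
    have := mem_subgradient_iff.1 hpx y
    dsimp only
    linarith
  have hmin : IsLocalMin (fun q => legendreOn u K q - innerSL ℝ x q) p := by
    refine Filter.Eventually.of_forall fun q => ?_
    have h1 := le_legendreOn hu hK hx q
    simp only [innerSL_apply_apply]
    rw [real_inner_comm p x, real_inner_comm q x]
    linarith
  exact sub_eq_zero.mp (hmin.hasFDerivAt_eq_zero (hp.hasFDerivAt.sub (innerSL ℝ x).hasFDerivAt))

theorem measurable_gradient (f : EuclideanSpace ℝ (Fin n) → ℝ) : Measurable (gradient f) :=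
  (InnerProductSpace.toDual ℝ (EuclideanSpace ℝ (Fin n))).symm.continuous.measurable.comp
    (measurable_fderiv ℝ f)

theorem gradient_legendreOn (hu : Continuous u) (hK : IsCompact K)
    {p x : EuclideanSpace ℝ (Fin n)} (hp : DifferentiableAt ℝ (legendreOn u K) p) (hx : x ∈ K)
    (hpx : p ∈ subgradient u x) : gradient (legendreOn u K) p = x := by
  rw [gradient, fderiv_legendreOn hu hK hp hx hpx]
  exact (InnerProductSpace.toDual ℝ (EuclideanSpace ℝ (Fin n))).symm_apply_apply x

/-- The gradient of the Legendre transform pushes Lebesgue measure forward to the Monge-Ampère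
measure. -/
theorem map_gradient_legendreOn (hu : Continuous u) (hK : IsCompact K) :
    (volume.restrict (subgradientImage u K)).map (gradient (legendreOn u K)) =
      (mongeAmpere u hu).restrict K := by
  rcases K.eq_empty_or_nonempty with rfl | hne
  · simp [subgradientImage]
  ext A hA
  rw [Measure.map_apply (measurable_gradient _) hA, Measure.restrict_apply hA,
    Measure.restrict_apply (measurable_gradient _ hA),
    mongeAmpere_apply hu (hA.inter hK.measurableSet)]
  -- By Rademacher, almost every p is a point of differentiability; there the gradient is the only
  -- point of K with subgradient p.
  obtain ⟨C, hC⟩ := exists_lipschitzWith_legendreOn hu hK hne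
  apply measure_congr
  filter_upwards [hC.ae_differentiableAt] with p hp
  apply propext
  change (gradient (legendreOn u K) p ∈ A ∧ p ∈ subgradientImage u K) ↔
    p ∈ subgradientImage u (A ∩ K)
  simp only [mem_subgradientImage]
  constructor
  · rintro ⟨h, x, hx, hpx⟩
    rw [gradient_legendreOn hu hK hp hx hpx] at h
    exact ⟨x, ⟨h, hx⟩, hpx⟩
  · rintro ⟨x, ⟨hxA, hx⟩, hpx⟩
    rw [gradient_legendreOn hu hK hp hx hpx]
    exact ⟨hxA, x, hx, hpx⟩

theorem mongeAmpere_lt_top (hu : Continuous u) (hK : IsCompact K) : mongeAmpere u hu K < ⊤ := by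
  rw [mongeAmpere_apply hu hK.measurableSet]
  exact (isBounded_subgradientImage hu hK).measure_lt_top

theorem integrableOn_id_mongeAmpere (hu : Continuous u) (hK : IsCompact K) :
    IntegrableOn (fun x => x) K (mongeAmpere u hu) := by
  obtain ⟨R, hR⟩ := hK.isBounded.exists_norm_le
  exact Measure.integrableOn_of_bounded (mongeAmpere_lt_top hu hK).ne
    measurable_id.aestronglyMeasurable
    ((ae_restrict_iff' hK.measurableSet).2 (Filter.Eventually.of_forall hR))

theorem integrableOn_gradient_legendreOn (hu : Continuous u) (hK : IsCompact K) :
    IntegrableOn (gradient (legendreOn u K)) (subgradientImage u K) := by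
  have h := integrableOn_id_mongeAmpere hu hK
  rw [IntegrableOn, ← map_gradient_legendreOn hu hK] at h
  exact h.comp_measurable (measurable_gradient _)

theorem setIntegral_id_mongeAmpere (hu : Continuous u) (hK : IsCompact K) :
    ∫ x in K, x ∂(mongeAmpere u hu) =
      ∫ p in subgradientImage u K, gradient (legendreOn u K) p := by
  rw [← map_gradient_legendreOn hu hK]
  exact integral_map (measurable_gradient _).aemeasurable measurable_id.aestronglyMeasurable

end Legendre

/-- A maximiser of ⟨p, ·⟩ - u inside Ω would be a local, hence by convexity global, minimiser of the
tilted u, putting p in the subgradient image. So the maximiser is on the boundary, where u = v, and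
it competes in the supremum for v. -/
theorem legendreOn_le_of_notMem {n : ℕ} {Ω : Set (EuclideanSpace ℝ (Fin n))}
    (hopen : IsOpen Ω) (hbdd : Bornology.IsBounded Ω) (hne : Ω.Nonempty)
    {u v : EuclideanSpace ℝ (Fin n) → ℝ}
    (hu : Continuous u) (hv : Continuous v) (huc : ConvexOn ℝ univ u)
    (huv : ∀ x, x ∉ Ω → u x = v x) {p : EuclideanSpace ℝ (Fin n)}
    (hp : p ∉ subgradientImage u (closure Ω)) :
    legendreOn u (closure Ω) p ≤ legendreOn v (closure Ω) p := by
  obtain ⟨x, hx, he, hmin⟩ := exists_legendreOn_eq hu hbdd.isCompact_closure hne.closure p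
  have hxΩ : x ∉ Ω := by
    intro hxΩ
    have hloc : IsLocalMin (fun y => u y - ⟪p, y⟫) x := by
      filter_upwards [hopen.mem_nhds hxΩ] with y hy using hmin y (subset_closure hy)
    exact hp (mem_subgradientImage.2 ⟨x, hx, mem_subgradient_iff.2
      (IsMinOn.of_isLocalMin_of_convex_univ hloc (huc.sub_inner p))⟩)
  rw [he, huv x hxΩ]
  exact le_legendreOn hv hbdd.isCompact_closure hx p

/-- The line derivatives of a compactly supported Lipschitz function have integral zero. -/
theorem LipschitzWith.integral_lineDeriv_eq_zero {n : ℕ} {f : EuclideanSpace ℝ (Fin n) → ℝ}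
    {C : NNReal} (hf : LipschitzWith C f) (hs : HasCompactSupport f)
    (v : EuclideanSpace ℝ (Fin n)) : ∫ x, lineDeriv ℝ f x v = 0 := by
  -- Integration by parts against the constant 1; it reverses the direction, hence `-v`.
  have h := LipschitzWith.integral_lineDeriv_mul_eq (μ := volume)
    (LipschitzWith.const (α := EuclideanSpace ℝ (Fin n)) (1 : ℝ)) hf hs (-v)
  simpa [lineDeriv] using h.symm

/-- The first moments of the Monge-Ampère measures of two convex functions which agree outside
a bounded open set agree. -/
theorem setIntegral_id_mongeAmpere_eq {n : ℕ} {Ω : Set (EuclideanSpace ℝ (Fin n))}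
    (hopen : IsOpen Ω) (hbdd : Bornology.IsBounded Ω) {u v : EuclideanSpace ℝ (Fin n) → ℝ}
    (hu : Continuous u) (hv : Continuous v) (huc : ConvexOn ℝ univ u) (hvc : ConvexOn ℝ univ v)
    (huv : ∀ x, x ∉ Ω → u x = v x) :
    ∫ x in closure Ω, x ∂(mongeAmpere u hu) = ∫ x in closure Ω, x ∂(mongeAmpere v hv) := by
  rcases Ω.eq_empty_or_nonempty with rfl | hne
  · simp
  have hK := hbdd.isCompact_closure
  have hP := subgradientImage_closure_eq hopen hbdd hu hv huc hvc huv
  have hiu := integrableOn_gradient_legendreOn hu hK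
  have hiv := integrableOn_gradient_legendreOn hv hK
  rw [setIntegral_id_mongeAmpere hu hK, setIntegral_id_mongeAmpere hv hK]
  rw [← hP] at hiv ⊢
  set P := subgradientImage u (closure Ω) with hPdef
  have hPc : IsClosed P := isClosed_subgradientImage hu hK
  have hPk : IsCompact P := Metric.isCompact_of_isClosed_isBounded hPc
    (isBounded_subgradientImage hu hK)
  obtain ⟨C, hC⟩ := exists_lipschitzWith_legendreOn hu hK hne.closure
  obtain ⟨D, hD⟩ := exists_lipschitzWith_legendreOn hv hK hne.closure
  set f := legendreOn u (closure Ω)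
  set g := legendreOn v (closure Ω)
  have hfg : ∀ p ∉ P, f p - g p = 0 := by
    intro p hp
    refine sub_eq_zero.2 (le_antisymm (legendreOn_le_of_notMem hopen hbdd hne hu hv huc huv hp) ?_)
    refine legendreOn_le_of_notMem hopen hbdd hne hv hu hvc (fun x hx => (huv x hx).symm) ?_
    rwa [← hP]
  have hsupp : HasCompactSupport fun p => f p - g p := HasCompactSupport.intro hPk hfg
  rw [← sub_eq_zero, ← integral_sub hiu hiv]
  refine ext_inner_left ℝ fun v => ?_
  have hin : ∫ p in P, ⟪v, gradient f p - gradient g p⟫ =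
      ⟪v, ∫ p in P, (gradient f p - gradient g p)⟫ := integral_inner (hiu.sub hiv) v
  rw [inner_zero_right, ← hin,
    ← (hC.sub hD).integral_lineDeriv_eq_zero hsupp v,
    ← setIntegral_eq_integral_of_forall_compl_eq_zero (s := P)
      (f := fun p => lineDeriv ℝ (fun p => f p - g p) p v)]
  · apply integral_congr_ae
    filter_upwards [ae_restrict_of_ae hC.ae_differentiableAt,
      ae_restrict_of_ae hD.ae_differentiableAt] with p hp hq
    rw [DifferentiableAt.lineDeriv_eq_fderiv (hp.fun_sub hq), fderiv_fun_sub hp hq, inner_sub_right,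
      real_inner_comm, real_inner_comm _ v, gradient, gradient,
      InnerProductSpace.toDual_symm_apply, InnerProductSpace.toDual_symm_apply]
    rfl
  -- The complement of P is open and f - g vanishes on it, so the line derivative does too and the
  -- integral over P is the integral over the whole space.
  · intro p hp
    have : (fun p => f p - g p) =ᶠ[nhds p] fun _ => 0 := by
      filter_upwards [hPc.isOpen_compl.mem_nhds hp] with q hq using hfg q hq
    rw [this.lineDeriv_eq]
    simp [lineDeriv]

/-! ### The null Lagrangian identity for smooth functions. -/

/-- The Hessian matrix of a function. -/
noncomputable def hessian {n : ℕ} (g : EuclideanSpace ℝ (Fin n) → ℝ)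
    (x : EuclideanSpace ℝ (Fin n)) : Matrix (Fin n) (Fin n) ℝ :=
  Matrix.of fun i j =>
    fderiv ℝ (fun y => fderiv ℝ g y (EuclideanSpace.single i 1)) x (EuclideanSpace.single j 1)

section Hessian

variable {n : ℕ} {g w : EuclideanSpace ℝ (Fin n) → ℝ}

theorem ContDiff.differentiable_fderiv (hg : ContDiff ℝ ∞ g) :
    Differentiable ℝ (fderiv ℝ g) :=
  (hg.fderiv_right (m := 1) (by norm_cast)).differentiable (by simp)

theorem hessian_apply (hg : ContDiff ℝ ∞ g) (x : EuclideanSpace ℝ (Fin n)) (i j : Fin n) :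
    hessian g x i j =
      fderiv ℝ (fderiv ℝ g) x (EuclideanSpace.single j 1) (EuclideanSpace.single i 1) := by
  rw [hessian, Matrix.of_apply, fderiv_clm_apply (hg.differentiable_fderiv x) (by fun_prop)]
  simp

theorem hessian_add (hg : ContDiff ℝ ∞ g) (hw : ContDiff ℝ ∞ w) (x : EuclideanSpace ℝ (Fin n)) :
    hessian (g + w) x = hessian g x + hessian w x := by
  have h : fderiv ℝ (g + w) = fderiv ℝ g + fderiv ℝ w := by
    ext1 y
    exact fderiv_add (hg.differentiable (by simp) y) (hw.differentiable (by simp) y)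
  ext i j
  have hgw : ContDiff ℝ ∞ (g + w) := hg.add hw
  rw [hessian_apply hgw, Matrix.add_apply, hessian_apply hg, hessian_apply hw, h,
    fderiv_add (hg.differentiable_fderiv x) (hw.differentiable_fderiv x)]
  rfl

theorem hessian_const_smul (hw : ContDiff ℝ ∞ w) (t : ℝ) (x : EuclideanSpace ℝ (Fin n)) :
    hessian (t • w) x = t • hessian w x := by
  have h : fderiv ℝ (t • w) = t • fderiv ℝ w := by
    ext1 y
    exact fderiv_const_smul (hw.differentiable (by simp) y) t
  ext i j
  have htw : ContDiff ℝ ∞ (t • w) := hw.const_smul t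
  rw [hessian_apply htw, Matrix.smul_apply, hessian_apply hw, h,
    fderiv_const_smul (hw.differentiable_fderiv x) t]
  rfl

theorem continuous_hessian (hg : ContDiff ℝ ∞ g) : Continuous (hessian g) := by
  refine continuous_matrix fun i j => ?_
  simp_rw [hessian_apply hg]
  have := (hg.fderiv_right (m := 1) (by norm_cast)).continuous_fderiv (by simp)
  fun_prop

/-- The inverse of the Riesz isomorphism, as a linear map. -/
noncomputable def dualToSelf (n : ℕ) :
    StrongDual ℝ (EuclideanSpace ℝ (Fin n)) →L[ℝ] EuclideanSpace ℝ (Fin n) where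
  toFun := (InnerProductSpace.toDual ℝ (EuclideanSpace ℝ (Fin n))).symm
  map_add' := map_add _
  map_smul' c l := by simp
  cont := (InnerProductSpace.toDual ℝ (EuclideanSpace ℝ (Fin n))).symm.continuous

/-- The derivative of the gradient. -/
noncomputable def hessianCLM (g : EuclideanSpace ℝ (Fin n) → ℝ) (x : EuclideanSpace ℝ (Fin n)) :
    EuclideanSpace ℝ (Fin n) →L[ℝ] EuclideanSpace ℝ (Fin n) :=
  (dualToSelf n).comp (fderiv ℝ (fderiv ℝ g) x)

theorem hasFDerivAt_gradient (hg : ContDiff ℝ ∞ g) (x : EuclideanSpace ℝ (Fin n)) :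
    HasFDerivAt (gradient g) (hessianCLM g x) x :=
  (dualToSelf n).hasFDerivAt.comp x (hg.differentiable_fderiv x).hasFDerivAt

theorem inner_hessianCLM (x v w : EuclideanSpace ℝ (Fin n)) :
    ⟪hessianCLM g x v, w⟫ = fderiv ℝ (fderiv ℝ g) x v w :=
  InnerProductSpace.toDual_symm_apply (𝕜 := ℝ)

theorem inner_gradient (x v : EuclideanSpace ℝ (Fin n)) :
    ⟪gradient g x, v⟫ = fderiv ℝ g x v :=
  InnerProductSpace.toDual_symm_apply (𝕜 := ℝ)

theorem toMatrix_hessianCLM_add (hg : ContDiff ℝ ∞ g) (x : EuclideanSpace ℝ (Fin n)) (C : ℝ) :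
    LinearMap.toMatrix (EuclideanSpace.basisFun (Fin n) ℝ).toBasis
      (EuclideanSpace.basisFun (Fin n) ℝ).toBasis
      (hessianCLM g x + C • ContinuousLinearMap.id ℝ _ : _ →L[ℝ] _).toLinearMap =
      hessian g x + C • (1 : Matrix (Fin n) (Fin n) ℝ) := by
  ext i j
  have h : (hessianCLM g x (EuclideanSpace.single j 1)) i = hessian g x i j := by
    rw [hessian_apply hg, ← inner_hessianCLM]
    simp [EuclideanSpace.inner_single_right]
  rw [LinearMap.toMatrix_apply]
  simp [h, Matrix.one_apply]

theorem det_hessianCLM_add (hg : ContDiff ℝ ∞ g) (x : EuclideanSpace ℝ (Fin n)) (C : ℝ) :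
    (hessianCLM g x + C • ContinuousLinearMap.id ℝ _).det =
      (hessian g x + C • (1 : Matrix (Fin n) (Fin n) ℝ)).det := by
  rw [← toMatrix_hessianCLM_add hg, LinearMap.det_toMatrix]

/-- Second order Taylor bounds: `L` bounds the second derivative of `g`. -/
theorem exists_taylor_bound (hg : ContDiff ℝ ∞ g) (hs : HasCompactSupport g) :
    ∃ L : ℝ, 0 ≤ L ∧ (∀ x y, |g y - g x - ⟪gradient g x, y - x⟫| ≤ L * ‖y - x‖ ^ 2) ∧
      ∀ x, ‖fderiv ℝ (fderiv ℝ g) x‖ ≤ L := by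
  obtain ⟨L, hL⟩ := (hg.fderiv_right (m := 1) (by norm_cast)).lipschitzWith_of_hasCompactSupport
    (hs.fderiv ℝ) (by simp)
  refine ⟨L, L.2, fun x y => ?_, fun x => norm_fderiv_le_of_lipschitz ℝ hL⟩
  have h := (convex_segment (𝕜 := ℝ) x y).norm_image_sub_le_of_norm_hasFDerivWithin_le'
    (f := g) (f' := fderiv ℝ g) (φ := fderiv ℝ g x) (C := L * ‖y - x‖)
    (fun z _ => (hg.differentiable (by simp) z).hasFDerivAt.hasFDerivWithinAt) ?_
    (left_mem_segment ℝ x y) (right_mem_segment ℝ x y)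
  · rw [gradient, InnerProductSpace.toDual_symm_apply]
    calc _ ≤ L * ‖y - x‖ * ‖y - x‖ := h
      _ = _ := by ring
  · intro z hz
    refine (hL.norm_sub_le z x).trans ?_
    gcongr
    simpa [dist_eq_norm] using norm_sub_le_of_mem_segment hz

theorem hasFDerivAt_add_sq (hg : ContDiff ℝ ∞ g) (C : ℝ) (x : EuclideanSpace ℝ (Fin n)) :
    HasFDerivAt (fun y => g y + C / 2 * ‖y‖ ^ 2) (innerSL ℝ (gradient g x + C • x)) x := by
  have h1 := (hg.differentiable (by simp) x).hasFDerivAt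
  have h2 := ((hasStrictFDerivAt_norm_sq x).hasFDerivAt).const_mul (C / 2)
  have h : innerSL ℝ (gradient g x + C • x) =
      fderiv ℝ g x + (C / 2) • 2 • innerSL ℝ x := by
    ext1 v
    have h : ⟪gradient g x + C • x, v⟫ = fderiv ℝ g x v + C * ⟪x, v⟫ := by
      rw [inner_add_left, inner_gradient, real_inner_smul_left]
    simp only [innerSL_apply_apply, h, add_apply,
      smul_apply, nsmul_eq_mul, smul_eq_mul]
    push_cast
    ring
  rw [h]
  exact h1.fun_add h2

/-- The quadratic term outweighs the Taylor error. The surplus C/2 - L yields convexity, and also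
strict monotonicity of the gradient. -/
theorem add_sq_lower_bound {L C : ℝ}
    (hL : ∀ x y, |g y - g x - ⟪gradient g x, y - x⟫| ≤ L * ‖y - x‖ ^ 2)
    (x y : EuclideanSpace ℝ (Fin n)) :
    ⟪gradient g x + C • x, y - x⟫ + (g x + C / 2 * ‖x‖ ^ 2) + (C / 2 - L) * ‖y - x‖ ^ 2 ≤
      g y + C / 2 * ‖y‖ ^ 2 := by
  have h1 := (abs_le.1 (hL x y)).1
  have h2 : ‖y‖ ^ 2 = ‖x‖ ^ 2 + 2 * ⟪x, y - x⟫ + ‖y - x‖ ^ 2 := by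
    rw [← norm_add_sq_real, add_sub_cancel]
  rw [inner_add_left, inner_smul_left, h2]
  simp only [conj_trivial]
  linarith

theorem subgradient_add_sq (hg : ContDiff ℝ ∞ g) {L C : ℝ} (hC : 2 * L < C)
    (hL : ∀ x y, |g y - g x - ⟪gradient g x, y - x⟫| ≤ L * ‖y - x‖ ^ 2)
    (x : EuclideanSpace ℝ (Fin n)) :
    subgradient (fun y => g y + C / 2 * ‖y‖ ^ 2) x = {gradient g x + C • x} := by
  refine Subset.antisymm (fun p hp => ?_) (singleton_subset_iff.2 fun y => ?_)
  · rw [mem_subgradient_iff] at hp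
    have hmin : IsLocalMin (fun y => (g y + C / 2 * ‖y‖ ^ 2) - innerSL ℝ p y) x :=
      Filter.Eventually.of_forall hp
    have h0 := hmin.hasFDerivAt_eq_zero
      ((hasFDerivAt_add_sq hg C x).sub (innerSL ℝ p).hasFDerivAt)
    refine mem_singleton_iff.2 (ext_inner_right ℝ fun v => ?_)
    exact (congrArg (fun L => L v) (sub_eq_zero.mp h0)).symm
  · have := add_sq_lower_bound (C := C) hL x y
    have : 0 ≤ (C / 2 - L) * ‖y - x‖ ^ 2 := mul_nonneg (by linarith) (by positivity)
    linarith

/-- A function with a subgradient at every point is convex. -/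
theorem convexOn_of_subgradient_nonempty {f : EuclideanSpace ℝ (Fin n) → ℝ}
    (h : ∀ x, (subgradient f x).Nonempty) : ConvexOn ℝ univ f := by
  refine ⟨convex_univ, fun x _ y _ a b ha hb hab => ?_⟩
  obtain ⟨p, hp⟩ := h (a • x + b • y)
  rw [mem_subgradient_iff] at hp
  have h1 := mul_le_mul_of_nonneg_left (hp x) ha
  have h2 := mul_le_mul_of_nonneg_left (hp y) hb
  have h3 : ⟪p, a • x + b • y⟫ = a * ⟪p, x⟫ + b * ⟪p, y⟫ := by
    rw [inner_add_right, inner_smul_right, inner_smul_right]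
  have h4 : ∀ c : ℝ, a * c + b * c = c := fun c => by rw [← add_mul, hab, one_mul]
  rw [smul_eq_mul, smul_eq_mul]
  linarith [h4 (f (a • x + b • y) - ⟪p, a • x + b • y⟫)]

/-- Adding the lower bounds at x and at y cancels the equal gradients and leaves (C - 2L)‖y - x‖² ≤
0. -/
theorem injective_gradient_add {L C : ℝ} (hC : 2 * L < C)
    (hL : ∀ x y, |g y - g x - ⟪gradient g x, y - x⟫| ≤ L * ‖y - x‖ ^ 2) :
    Function.Injective (fun x => gradient g x + C • x) := by
  intro x y hxy
  have h1 := add_sq_lower_bound (C := C) hL x y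
  have h2 := add_sq_lower_bound (C := C) hL y x
  dsimp only at hxy
  rw [hxy] at h1
  rw [norm_sub_rev, ← neg_sub y x, inner_neg_right] at h2
  have h3 : (C - 2 * L) * ‖y - x‖ ^ 2 ≤ 0 := by linarith
  have h4 : ‖y - x‖ ^ 2 ≤ 0 := nonpos_of_mul_nonpos_right h3 (by linarith)
  have h5 : ‖y - x‖ = 0 := by nlinarith [norm_nonneg (y - x)]
  exact (sub_eq_zero.1 (norm_eq_zero.1 h5)).symm

/-- The symmetric form D²g is bounded below by -L, so adding C ≥ L times the identity makes it
positive semidefinite. -/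
theorem det_hessian_add_nonneg (hg : ContDiff ℝ ∞ g) {L C : ℝ} (hC : L ≤ C)
    {x : EuclideanSpace ℝ (Fin n)} (hL : ‖fderiv ℝ (fderiv ℝ g) x‖ ≤ L) :
    0 ≤ (hessian g x + C • (1 : Matrix (Fin n) (Fin n) ℝ)).det := by
  have hpos :
      (hessianCLM g x + C • ContinuousLinearMap.id ℝ _ : _ →L[ℝ] _).toLinearMap.IsPositive := by
    refine ⟨fun v w => ?_, fun v => ?_⟩
    · simp [inner_add_left, inner_add_right, inner_smul_left, inner_smul_right,
        inner_hessianCLM]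
      rw [real_inner_comm, inner_hessianCLM]
      exact (hg.contDiffAt.isSymmSndFDerivAt (by simp; norm_cast)).eq _ _
    · have h := (fderiv ℝ (fderiv ℝ g) x).le_opNorm₂ v v
      have h1 : ‖fderiv ℝ (fderiv ℝ g) x‖ * ‖v‖ * ‖v‖ ≤ C * ‖v‖ * ‖v‖ := by
        gcongr
        exact hL.trans hC
      have h2 := (abs_le.1 (h.trans h1)).1
      simp [inner_add_left, inner_smul_left, inner_hessianCLM]
      linarith
  rw [← toMatrix_hessianCLM_add hg]
  exact ((LinearMap.posSemidef_toMatrix_iff _).2 hpos).det_nonneg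

/-- The subgradient image is the image under an injective smooth gradient map, whose volume is the
integral of its Jacobian determinant. -/
theorem mongeAmpere_add_sq (hg : ContDiff ℝ ∞ g) {L C : ℝ} (hL0 : 0 ≤ L) (hC : 2 * L < C)
    (hL : ∀ x y, |g y - g x - ⟪gradient g x, y - x⟫| ≤ L * ‖y - x‖ ^ 2)
    (hL' : ∀ x, ‖fderiv ℝ (fderiv ℝ g) x‖ ≤ L)
    (hc : Continuous fun y => g y + C / 2 * ‖y‖ ^ 2) :
    mongeAmpere (fun y => g y + C / 2 * ‖y‖ ^ 2) hc =
      volume.withDensity fun x =>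
        ENNReal.ofReal (hessian g x + C • (1 : Matrix (Fin n) (Fin n) ℝ)).det := by
  ext A hA
  rw [mongeAmpere_apply hc hA, withDensity_apply _ hA]
  have himg : subgradientImage (fun y => g y + C / 2 * ‖y‖ ^ 2) A =
      (fun x => gradient g x + C • x) '' A := by
    ext p
    simp [subgradientImage, subgradient_add_sq hg hC hL, eq_comm]
  rw [himg, ← lintegral_abs_det_fderiv_eq_addHaar_image volume hA
    (f := fun x => gradient g x + C • x)
    (f' := fun x => hessianCLM g x + C • ContinuousLinearMap.id ℝ _)
    (fun x _ => ((hasFDerivAt_gradient hg x).fun_add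
      ((hasFDerivAt_id x).fun_const_smul C)).hasFDerivWithinAt)
    (injective_gradient_add hC hL).injOn]
  refine lintegral_congr fun x => ?_
  rw [det_hessianCLM_add hg, abs_of_nonneg (det_hessian_add_nonneg hg (by linarith) (hL' x))]

theorem continuous_det_hessian_add (hg : ContDiff ℝ ∞ g) (C : ℝ) :
    Continuous fun x => (hessian g x + C • (1 : Matrix (Fin n) (Fin n) ℝ)).det :=
  ((continuous_hessian hg).add continuous_const).matrix_det

/-- For large `C`, adding `C / 2 * |x| ^ 2` makes the Monge-Ampère measure have the Hessian
determinant as its density. -/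
theorem exists_setIntegral_mongeAmpere_add_sq (hg : ContDiff ℝ ∞ g) (hs : HasCompactSupport g) :
    ∃ C₀ : ℝ, ∀ C > C₀, ConvexOn ℝ univ (fun y => g y + C / 2 * ‖y‖ ^ 2) ∧
      ∀ (hc : Continuous fun y => g y + C / 2 * ‖y‖ ^ 2) (K : Set (EuclideanSpace ℝ (Fin n))),
      MeasurableSet K → ∫ x in K, x ∂(mongeAmpere (fun y => g y + C / 2 * ‖y‖ ^ 2) hc) =
        ∫ x in K, (hessian g x + C • (1 : Matrix (Fin n) (Fin n) ℝ)).det • x := by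
  obtain ⟨L, hL0, hL, hL'⟩ := exists_taylor_bound hg hs
  refine ⟨2 * L, fun C hC => ⟨convexOn_of_subgradient_nonempty fun x => ?_, fun hc K hK => ?_⟩⟩
  · rw [subgradient_add_sq hg hC hL]
    exact singleton_nonempty _
  · rw [mongeAmpere_add_sq hg hL0 hC hL hL' hc, restrict_withDensity hK,
      integral_withDensity_eq_integral_toReal_smul
        (continuous_det_hessian_add hg C).measurable.ennreal_ofReal (by simp)]
    refine integral_congr_ae (Filter.Eventually.of_forall fun x => ?_)
    dsimp only
    rw [ENNReal.toReal_ofReal (det_hessian_add_nonneg hg (by linarith) (hL' x))]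

theorem exists_setIntegral_det_add_eq {Ω : Set (EuclideanSpace ℝ (Fin n))}
    (hopen : IsOpen Ω) (hbdd : Bornology.IsBounded Ω)
    (hg : ContDiff ℝ ∞ g) (hs : HasCompactSupport g) (hw : ContDiff ℝ ∞ w)
    (hws : HasCompactSupport w) (hwΩ : ∀ x, x ∉ Ω → w x = 0) :
    ∃ C₀ : ℝ, ∀ C > C₀,
      ∫ x in closure Ω, (hessian g x + C • (1 : Matrix (Fin n) (Fin n) ℝ)).det • x =
      ∫ x in closure Ω, (hessian (g + w) x + C • (1 : Matrix (Fin n) (Fin n) ℝ)).det • x := by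
  obtain ⟨C₁, h₁⟩ := exists_setIntegral_mongeAmpere_add_sq hg hs
  obtain ⟨C₂, h₂⟩ := exists_setIntegral_mongeAmpere_add_sq (g := g + w) (hg.add hw)
    (hs.add hws)
  refine ⟨max C₁ C₂, fun C hC => ?_⟩
  obtain ⟨hc₁, hI₁⟩ := h₁ C ((le_max_left _ _).trans_lt hC)
  obtain ⟨hc₂, hI₂⟩ := h₂ C ((le_max_right _ _).trans_lt hC)
  have hgc := hg.continuous
  have hwc := hw.continuous
  have hk₁ : Continuous fun y => g y + C / 2 * ‖y‖ ^ 2 := by fun_prop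
  have hk₂ : Continuous fun y => (g + w) y + C / 2 * ‖y‖ ^ 2 := by fun_prop
  rw [← hI₁ hk₁ _ isClosed_closure.measurableSet, ← hI₂ hk₂ _ isClosed_closure.measurableSet]
  refine setIntegral_id_mongeAmpere_eq hopen hbdd hk₁ hk₂ hc₁ hc₂ fun x hx => ?_
  simp [hwΩ x hx]

/-- The determinant of a matrix is a fixed linear combination of determinants of its translates by
large multiples of the identity. -/
theorem exists_det_eq_sum_det_add (n : ℕ) (C₀ : ℝ) :
    ∃ (c : ℕ → ℝ) (C : ℕ → ℝ), (∀ i, C₀ < C i) ∧ ∀ M : Matrix (Fin n) (Fin n) ℝ,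
      M.det = ∑ i ∈ Finset.range (n + 1), c i * (M + C i • (1 : Matrix (Fin n) (Fin n) ℝ)).det := by
  set C : ℕ → ℝ := fun i => C₀ + 1 + i with hCdef
  refine ⟨fun i => (Lagrange.basis (Finset.range (n + 1)) C i).eval 0, C, fun i => ?_,
    fun M => ?_⟩
  · simp only [hCdef]
    linarith [Nat.cast_nonneg (α := ℝ) i]
  have hinj : Set.InjOn C (Finset.range (n + 1)) := by
    intro i _ j _ hij
    simpa [hCdef] using hij
  -- As a function of r, det(M + r I) is a polynomial of degree n. Its value at 0 is interpolated
  -- from n + 1 nodes, with weights independent of M.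
  have heval : ∀ r : ℝ, (-M).charpoly.eval r = (M + r • (1 : Matrix (Fin n) (Fin n) ℝ)).det := by
    intro r
    rw [Matrix.eval_charpoly, sub_neg_eq_add, add_comm, Matrix.smul_one_eq_diagonal,
      Matrix.scalar_apply]
  have hdeg : (-M).charpoly.degree < (Finset.range (n + 1)).card := by
    rw [Matrix.charpoly_degree_eq_dim]
    simp only [Fintype.card_fin, Finset.card_range]
    exact_mod_cast Nat.lt_succ_self n
  have h := congrArg (Polynomial.eval 0) (Lagrange.eq_interpolate hinj hdeg)
  rw [heval, zero_smul, add_zero, Lagrange.interpolate_apply, Polynomial.eval_finsetSum] at h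
  rw [h]
  refine Finset.sum_congr rfl fun i _ => ?_
  rw [Polynomial.eval_mul, Polynomial.eval_C, heval, mul_comm]

/-- The first moment of the Hessian determinant is a null Lagrangian on smooth functions. -/
theorem setIntegral_det_hessian_add {Ω : Set (EuclideanSpace ℝ (Fin n))}
    (hopen : IsOpen Ω) (hbdd : Bornology.IsBounded Ω)
    (hg : ContDiff ℝ ∞ g) (hs : HasCompactSupport g) (hw : ContDiff ℝ ∞ w)
    (hws : HasCompactSupport w) (hwΩ : ∀ x, x ∉ Ω → w x = 0) :
    ∫ x in closure Ω, (hessian (g + w) x).det • x = ∫ x in closure Ω, (hessian g x).det • x := by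
  obtain ⟨C₀, hC₀⟩ := exists_setIntegral_det_add_eq hopen hbdd hg hs hw hws hwΩ
  obtain ⟨c, C, hC, hdet⟩ := exists_det_eq_sum_det_add n C₀
  have hsum : ∀ {f : EuclideanSpace ℝ (Fin n) → ℝ}, ContDiff ℝ ∞ f →
      ∫ x in closure Ω, (hessian f x).det • x = ∑ i ∈ Finset.range (n + 1), c i •
        ∫ x in closure Ω, (hessian f x + C i • (1 : Matrix (Fin n) (Fin n) ℝ)).det • x := by
    intro f hf
    simp_rw [fun x => hdet (hessian f x), Finset.sum_smul, mul_smul]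
    rw [integral_finsetSum]
    · simp_rw [integral_smul]
    · intro i _
      have hcont := ((continuous_det_hessian_add hf (C i)).smul continuous_id).continuousOn
        (s := closure Ω)
      exact (hcont.integrableOn_compact hbdd.isCompact_closure).smul (c i)
  rw [hsum hg, hsum (f := g + w) (hg.add hw)]
  exact Finset.sum_congr rfl fun i _ => by rw [hC₀ (C i) (hC i)]

end Hessian

/-! ### Mollification and weak derivatives. -/

section Mollify

open Filter Topology

variable {n : ℕ} {f g : EuclideanSpace ℝ (Fin n) → ℝ}

/-- The mollification of `f` by the bump function `η`. -/
noncomputable def mollify (η : ContDiffBump (0 : EuclideanSpace ℝ (Fin n)))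
    (f : EuclideanSpace ℝ (Fin n) → ℝ) (x : EuclideanSpace ℝ (Fin n)) : ℝ :=
  ∫ y, f y * η.normed volume (x - y)

theorem mollify_eq_convolution (η : ContDiffBump (0 : EuclideanSpace ℝ (Fin n)))
    (f : EuclideanSpace ℝ (Fin n) → ℝ) :
    mollify η f = convolution f (η.normed volume) (ContinuousLinearMap.mul ℝ ℝ) volume := rfl

theorem contDiff_mollify (η : ContDiffBump (0 : EuclideanSpace ℝ (Fin n)))
    (hf : LocallyIntegrable f) : ContDiff ℝ ∞ (mollify η f) := by
  rw [mollify_eq_convolution]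
  exact η.hasCompactSupport_normed.contDiff_convolution_right _ hf η.contDiff_normed

theorem fderiv_mollify (η : ContDiffBump (0 : EuclideanSpace ℝ (Fin n)))
    (hf : LocallyIntegrable f) (x v : EuclideanSpace ℝ (Fin n)) :
    fderiv ℝ (mollify η f) x v = ∫ y, f y * fderiv ℝ (η.normed volume) (x - y) v := by
  have hη : ContDiff ℝ 1 (η.normed (volume : Measure (EuclideanSpace ℝ (Fin n)))) :=
    η.contDiff_normed
  rw [mollify_eq_convolution, (η.hasCompactSupport_normed.hasFDerivAt_convolution_right
    (ContinuousLinearMap.mul ℝ ℝ) hf hη x).fderiv,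
    convolution_precompR_apply _ hf (η.hasCompactSupport_normed.fderiv ℝ)
      (hη.continuous_fderiv (by simp))]
  rfl

/-- The partial derivatives of the mollification are the mollifications of the weak partial
derivatives, away from the boundary. -/
theorem fderiv_mollify_indicator {U : Set (EuclideanSpace ℝ (Fin n))} (hU : IsOpen U) {i : Fin n}
    (η : ContDiffBump (0 : EuclideanSpace ℝ (Fin n))) (h : HasWeakPartialOn U i f g)
    (hf : LocallyIntegrable (U.indicator f)) {x : EuclideanSpace ℝ (Fin n)}
    (hx : Metric.closedBall x η.rOut ⊆ U) :
    fderiv ℝ (mollify η (U.indicator f)) x (EuclideanSpace.single i 1) =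
      mollify η (U.indicator g) x := by
  set ρ := η.normed (volume : Measure (EuclideanSpace ℝ (Fin n))) with hρdef
  have hρ : ContDiff ℝ ∞ ρ := η.contDiff_normed
  have hzero : ∀ y, y ∉ Metric.closedBall x η.rOut → ρ (x - y) = 0 := by
    intro y hy
    by_contra h0
    have h1 : x - y ∈ Function.support ρ := h0
    rw [hρdef, η.support_normed_eq, mem_ball_zero_iff] at h1
    exact hy (by rw [Metric.mem_closedBall', dist_eq_norm]; exact h1.le)
  have hts : tsupport (fun y => ρ (x - y)) ⊆ Metric.closedBall x η.rOut :=
    closure_minimal (fun y hy => by_contra fun h => hy (hzero y h)) Metric.isClosed_closedBall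
  -- The reflected kernel is an admissible test function; the sign from the reflection cancels the
  -- one in the definition of the weak derivative.
  have hφ := h.2.2 (fun y => ρ (x - y)) (hρ.comp (contDiff_const.sub contDiff_id))
    (HasCompactSupport.intro (isCompact_closedBall x η.rOut) hzero) (hts.trans hx)
  have hd : ∀ y, fderiv ℝ (fun y => ρ (x - y)) y (EuclideanSpace.single i 1) =
      -fderiv ℝ ρ (x - y) (EuclideanSpace.single i 1) := by
    intro y
    have h1 := (hρ.differentiable (by simp) (x - y)).hasFDerivAt.comp y
      ((hasFDerivAt_id y).const_sub x)
    have h2 : fderiv ℝ (fun y => ρ (x - y)) y = _ := h1.fderiv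
    rw [h2]
    simp
  simp_rw [hd, mul_neg, integral_neg] at hφ
  rw [fderiv_mollify η hf, mollify]
  have hind : ∀ k l : EuclideanSpace ℝ (Fin n) → ℝ,
      ∫ y, U.indicator k y * l y = ∫ y in U, k y * l y := by
    intro k l
    rw [← integral_indicator hU.measurableSet]
    simp_rw [indicator_mul_left]
  rw [hind, hind]
  exact neg_injective hφ

theorem integral_normed_sub (η : ContDiffBump (0 : EuclideanSpace ℝ (Fin n)))
    (x : EuclideanSpace ℝ (Fin n)) : ∫ y, η.normed volume (x - y) = 1 := by
  rw [integral_sub_left_eq_self (fun y => η.normed volume y) volume x, η.integral_normed]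

theorem abs_mollify_le (η : ContDiffBump (0 : EuclideanSpace ℝ (Fin n))) {B : ℝ}
    (hf : ∀ᵐ y, |f y| ≤ B) (x : EuclideanSpace ℝ (Fin n)) : |mollify η f x| ≤ B := by
  have hint : Integrable fun y => η.normed volume (x - y) :=
    (η.integrable_normed (μ := (volume : Measure (EuclideanSpace ℝ (Fin n))))).comp_sub_left x
  have h := norm_integral_le_of_norm_le (f := fun y => f y * η.normed volume (x - y))
    (hint.const_mul B) (by
      filter_upwards [hf] with y hy
      rw [norm_mul, Real.norm_eq_abs, Real.norm_eq_abs, abs_of_nonneg (η.nonneg_normed _)]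
      exact mul_le_mul_of_nonneg_right hy (η.nonneg_normed _))
  rwa [integral_const_mul, integral_normed_sub, mul_one] at h

theorem mollify_eq_zero (η : ContDiffBump (0 : EuclideanSpace ℝ (Fin n)))
    {Ω : Set (EuclideanSpace ℝ (Fin n))} (hf : ∀ᵐ y, y ∉ Ω → f y = 0)
    {x : EuclideanSpace ℝ (Fin n)} {δ : ℝ} (hδ : η.rOut ≤ δ) (hx : x ∉ Metric.thickening δ Ω) :
    mollify η f x = 0 := by
  apply integral_eq_zero_of_ae
  filter_upwards [hf] with y hy
  by_cases hyΩ : y ∈ Ω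
  · have h : x - y ∉ Function.support (η.normed volume) := by
      rw [η.support_normed_eq, mem_ball_zero_iff, not_lt, ← dist_eq_norm]
      by_contra! hlt
      exact hx (Metric.mem_thickening_iff.2 ⟨y, hyΩ, hlt.trans_le hδ⟩)
    rw [Function.notMem_support.1 h, mul_zero, Pi.zero_apply]
  · rw [hy hyΩ, zero_mul, Pi.zero_apply]

/-- Almost everywhere convergence of mollifications, evaluated at nearby points. -/
theorem ae_tendsto_mollify (hf : LocallyIntegrable f)
    {η : ℕ → ContDiffBump (0 : EuclideanSpace ℝ (Fin n))}
    (hη : Tendsto (fun m => (η m).rOut) atTop (𝓝 0)) (h2 : ∀ m, (η m).rOut ≤ 2 * (η m).rIn) :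
    ∀ᵐ x, ∀ (c : ℕ → EuclideanSpace ℝ (Fin n)) (K : ℝ), (∀ m, dist x (c m) ≤ K * (η m).rOut) →
      Tendsto (fun m => mollify (η m) f (c m)) atTop (𝓝 (f x)) := by
  -- Countably many integer K suffice, so a single null set serves all K; in the application K
  -- depends on x.
  have hall := ae_all_iff.2 fun K : ℕ =>
    IsUnifLocDoublingMeasure.ae_tendsto_average_norm_sub volume hf (K : ℝ)
  filter_upwards [hall] with x hx c K hc
  obtain ⟨k, hk⟩ := exists_nat_ge K
  have hη' : Tendsto (fun m => (η m).rOut) atTop (𝓝[>] 0) :=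
    tendsto_nhdsWithin_iff.2 ⟨hη, Eventually.of_forall fun m => (η m).rOut_pos⟩
  have hav := hx k c (fun m => (η m).rOut) hη' (Eventually.of_forall fun m =>
    (hc m).trans (mul_le_mul_of_nonneg_right hk (η m).rOut_pos.le))
  -- The factor 2ⁿ comes from `rOut ≤ 2 * rIn`: the kernel is at most 2ⁿ over the volume of its
  -- outer ball.
  have h := tendsto_integral_smul_of_tendsto_average_norm_sub
    (g := fun m y => (η m).normed volume (c m - y))
    (2 ^ Module.finrank ℝ (EuclideanSpace ℝ (Fin n))) hav ?_ ?_ ?_ ?_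
  · simpa only [mollify, smul_eq_mul, mul_comm] using h
  · exact Eventually.of_forall fun m => hf.integrableOn_isCompact (isCompact_closedBall _ _)
  · simp_rw [integral_normed_sub]
    exact tendsto_const_nhds
  · refine Eventually.of_forall fun m y hy => ?_
    have h1 : c m - y ∈ Function.support ((η m).normed volume) := hy
    rw [(η m).support_normed_eq, mem_ball_zero_iff] at h1
    rw [Metric.mem_closedBall', dist_eq_norm]
    exact h1.le
  · refine Eventually.of_forall fun m y => ?_
    rw [abs_of_nonneg ((η m).nonneg_normed _)]
    have h1 := (η m).normed_le_div_measure_closedBall_rOut volume 2 (h2 m) (c m - y)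
    rwa [Measure.real, ← Measure.addHaar_closedBall_center volume (c m), ← Measure.real] at h1

end Mollify

/-! ### Hessians of mollified W^{2,∞} functions. -/

section Sobolev

variable {n : ℕ} {U : Set (EuclideanSpace ℝ (Fin n))} {u : EuclideanSpace ℝ (Fin n) → ℝ}
  {H : EuclideanSpace ℝ (Fin n) → Matrix (Fin n) (Fin n) ℝ}

theorem MemLp.locallyIntegrable_indicator (hU : IsOpen U) (hu : MemLp u ⊤ (volume.restrict U)) :
    LocallyIntegrable (U.indicator u) :=
  ((memLp_indicator_iff_restrict hU.measurableSet).2 hu).locallyIntegrable le_top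

/-- The matrix of mollifications of the entries of `H`, extended by zero outside `U`. -/
noncomputable def mollifyMatrix (η : ContDiffBump (0 : EuclideanSpace ℝ (Fin n)))
    (U : Set (EuclideanSpace ℝ (Fin n)))
    (H : EuclideanSpace ℝ (Fin n) → Matrix (Fin n) (Fin n) ℝ) (x : EuclideanSpace ℝ (Fin n)) :
    Matrix (Fin n) (Fin n) ℝ :=
  Matrix.of fun i j => mollify η (U.indicator fun y => H y i j) x

/-- The margin `rOut < r` lets the first derivatives be identified on a whole neighbourhood of x, so
that they can be differentiated again. -/
theorem IsW2InftyOn.hessian_mollify (hU : IsOpen U) (h : IsW2InftyOn U u H)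
    (η : ContDiffBump (0 : EuclideanSpace ℝ (Fin n))) {x : EuclideanSpace ℝ (Fin n)} {r : ℝ}
    (hr : η.rOut < r) (hx : Metric.closedBall x r ⊆ U) :
    hessian (mollify η (U.indicator u)) x = mollifyMatrix η U H x := by
  obtain ⟨hu, G, hG, hH⟩ := h
  ext i j
  have hev : (fun y => fderiv ℝ (mollify η (U.indicator u)) y (EuclideanSpace.single i 1))
      =ᶠ[nhds x] mollify η (U.indicator (G i)) := by
    filter_upwards [Metric.closedBall_mem_nhds x (sub_pos.2 hr)] with y hy
    refine fderiv_mollify_indicator hU η (hG i).2 (MemLp.locallyIntegrable_indicator hU hu)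
      ((Metric.closedBall_subset_closedBall' ?_).trans hx)
    rw [Metric.mem_closedBall] at hy
    linarith
  rw [hessian, Matrix.of_apply, hev.fderiv_eq]
  exact fderiv_mollify_indicator hU η (hH i j).2 (MemLp.locallyIntegrable_indicator hU (hG i).1)
      ((Metric.closedBall_subset_closedBall hr.le).trans hx)

theorem IsW2InftyOn.continuous_mollifyMatrix (hU : IsOpen U) (h : IsW2InftyOn U u H)
    (η : ContDiffBump (0 : EuclideanSpace ℝ (Fin n))) : Continuous (mollifyMatrix η U H) := by
  obtain ⟨_, G, _, hH⟩ := h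
  exact continuous_matrix fun i j =>
    (contDiff_mollify η (MemLp.locallyIntegrable_indicator hU (hH i j).1)).continuous

theorem IsW2InftyOn.exists_ae_bound (hU : IsOpen U) (h : IsW2InftyOn U u H) :
    ∃ B : ℝ, 0 ≤ B ∧ ∀ i j, ∀ᵐ x, |U.indicator (fun y => H y i j) x| ≤ B := by
  obtain ⟨_, G, _, hH⟩ := h
  have hm : ∀ i j, MemLp (U.indicator fun y => H y i j) ⊤ volume := fun i j =>
    (memLp_indicator_iff_restrict hU.measurableSet).2 (hH i j).1
  set b : Fin n → Fin n → ℝ := fun i j => (eLpNorm (U.indicator fun y => H y i j) ⊤ volume).toReal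
  have hb : ∀ i j, 0 ≤ b i j := fun i j => ENNReal.toReal_nonneg
  refine ⟨∑ i, ∑ j, b i j, Finset.sum_nonneg fun i _ => Finset.sum_nonneg fun j _ => hb i j,
    fun i j => ?_⟩
  have hle : b i j ≤ ∑ i, ∑ j, b i j :=
    (Finset.single_le_sum (fun j _ => hb i j) (Finset.mem_univ j)).trans
      (Finset.single_le_sum (f := fun i => ∑ j, b i j)
        (fun i _ => Finset.sum_nonneg fun j _ => hb i j) (Finset.mem_univ i))
  filter_upwards [ae_le_eLpNormEssSup (f := U.indicator fun y => H y i j) (μ := volume)] with x hx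
  rw [← eLpNorm_exponent_top] at hx
  have h1 := ENNReal.toReal_mono (hm i j).2.ne hx
  rw [toReal_enorm, Real.norm_eq_abs] at h1
  exact h1.trans hle

theorem IsW2InftyOn.aemeasurable (h : IsW2InftyOn U u H) (i j : Fin n) :
    AEMeasurable (fun x => H x i j) (volume.restrict U) := by
  obtain ⟨_, G, _, hH⟩ := h
  exact (hH i j).1.1.aemeasurable

end Sobolev

theorem abs_det_le {n : ℕ} {M : Matrix (Fin n) (Fin n) ℝ} {B : ℝ} (h : ∀ i j, |M i j| ≤ B) :
    |M.det| ≤ n.factorial • B ^ n := by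
  have := Matrix.det_le (abv := AbsoluteValue.abs) (x := B) h
  rwa [Fintype.card_fin] at this

/-! ### Contraction of a convex set towards an interior point. -/

section Homothety

variable {n : ℕ} {f : EuclideanSpace ℝ (Fin n) → ℝ}

theorem fderiv_comp_homothety (hf : Differentiable ℝ f) (x₀ x v : EuclideanSpace ℝ (Fin n))
    (r : ℝ) : fderiv ℝ (fun x => f (AffineMap.homothety x₀ r x)) x v =
      r * fderiv ℝ f (AffineMap.homothety x₀ r x) v := by
  have h0 : HasFDerivAt (fun x => AffineMap.homothety x₀ r x)
      (r • ContinuousLinearMap.id ℝ (EuclideanSpace ℝ (Fin n))) x := by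
    simp only [AffineMap.homothety_apply, vsub_eq_sub, vadd_eq_add]
    exact (((hasFDerivAt_id x).sub_const x₀).fun_const_smul r).add_const x₀
  have h := (hf (AffineMap.homothety x₀ r x)).hasFDerivAt.comp x h0
  have h' : fderiv ℝ (fun x => f (AffineMap.homothety x₀ r x)) x = _ := h.fderiv
  rw [h']
  simp

theorem contDiff_comp_homothety (hf : ContDiff ℝ ∞ f) (x₀ : EuclideanSpace ℝ (Fin n)) (r : ℝ) :
    ContDiff ℝ ∞ (fun x => f (AffineMap.homothety x₀ r x)) := by
  simp only [AffineMap.homothety_apply, vsub_eq_sub, vadd_eq_add]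
  fun_prop

theorem hessian_comp_homothety (hf : ContDiff ℝ ∞ f) (x₀ x : EuclideanSpace ℝ (Fin n)) (r : ℝ) :
    hessian (fun x => f (AffineMap.homothety x₀ r x)) x =
      r ^ 2 • hessian f (AffineMap.homothety x₀ r x) := by
  ext i j
  have hd : Differentiable ℝ fun y => fderiv ℝ f y (EuclideanSpace.single i 1) := fun y =>
    (hf.differentiable_fderiv y).clm_apply (differentiableAt_const _)
  rw [Matrix.smul_apply, hessian, hessian, Matrix.of_apply, Matrix.of_apply]
  simp_rw [fun y => fderiv_comp_homothety (hf.differentiable (by simp)) x₀ y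
    (EuclideanSpace.single i 1) r]
  have hc : DifferentiableAt ℝ (fun y => fderiv ℝ f (AffineMap.homothety x₀ r y)
      (EuclideanSpace.single i 1)) x := by
    have h0 : DifferentiableAt ℝ (fun y : EuclideanSpace ℝ (Fin n) =>
        AffineMap.homothety x₀ r y) x := by
      simp only [AffineMap.homothety_apply, vsub_eq_sub, vadd_eq_add]
      fun_prop
    exact (hd (AffineMap.homothety x₀ r x)).comp x h0
  rw [fderiv_const_mul hc, smul_apply, fderiv_comp_homothety hd, smul_eq_mul, smul_eq_mul]
  ring

theorem hasCompactSupport_comp_homothety {x₀ : EuclideanSpace ℝ (Fin n)} {R r : ℝ} (hr : 0 < r)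
    (hf : ∀ x, R < dist x x₀ → f x = 0) :
    HasCompactSupport (fun x => f (AffineMap.homothety x₀ r x)) := by
  refine HasCompactSupport.intro (isCompact_closedBall x₀ (R / r)) fun x hx => hf _ ?_
  rw [Metric.mem_closedBall, not_le, div_lt_iff₀ hr] at hx
  rw [dist_homothety_center, Real.norm_eq_abs, abs_of_pos hr, dist_comm]
  linarith

/-- Shrinking a convex set towards an interior point moves it away from its boundary. -/
theorem closedBall_homothety_subset {Ω : Set (EuclideanSpace ℝ (Fin n))} (hΩ : Convex ℝ Ω)
    {x₀ x : EuclideanSpace ℝ (Fin n)} {R r ε δ : ℝ} (hball : Metric.ball x₀ R ⊆ Ω)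
    (hr0 : 0 ≤ r) (hr1 : r < 1) (hR : ε + δ ≤ (1 - r) * R) (hx : x ∈ Metric.thickening δ Ω) :
    Metric.closedBall (AffineMap.homothety x₀ r x) ε ⊆ Ω := by
  intro z hz
  obtain ⟨y, hy, hxy⟩ := Metric.mem_thickening_iff.1 hx
  rw [Metric.mem_closedBall, dist_eq_norm, AffineMap.homothety_apply, vsub_eq_sub,
    vadd_eq_add] at hz
  rw [dist_eq_norm] at hxy
  have h1r : 0 < 1 - r := by linarith
  -- This q solves z = r y + (1 - r) q. The point z is within less than ε + δ ≤ (1 - r) R of the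
  -- image of y, so q lies in the ball about x₀.
  set q := x₀ + (1 - r)⁻¹ • (z - (r • (y - x₀) + x₀)) with hq
  have hqΩ : q ∈ Ω := by
    apply hball
    rw [mem_ball_iff_norm, hq, add_sub_cancel_left, norm_smul, Real.norm_eq_abs,
      abs_of_pos (inv_pos.2 h1r), inv_mul_lt_iff₀ h1r]
    have e : z - (r • (y - x₀) + x₀) = (z - (r • (x - x₀) + x₀)) + r • (x - y) := by module
    calc ‖z - (r • (y - x₀) + x₀)‖ ≤ ‖z - (r • (x - x₀) + x₀)‖ + ‖r • (x - y)‖ := by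
          rw [e]; exact norm_add_le _ _
      _ ≤ ε + 1 * ‖x - y‖ := by
          rw [norm_smul, Real.norm_eq_abs, abs_of_nonneg hr0]
          gcongr
      _ < (1 - r) * R := by linarith
  have hz' : r • y + (1 - r) • q = z := by
    rw [hq, smul_add, smul_inv_smul₀ h1r.ne']
    module
  rw [← hz']
  exact hΩ hy hqΩ hr0 h1r.le (by ring)

end Homothety

/-! ### Passage to the limit for W^{2,∞} functions. -/

section NullLagrangian

open Filter Topology

variable {n : ℕ} {Ω : Set (EuclideanSpace ℝ (Fin n))} {u w : EuclideanSpace ℝ (Fin n) → ℝ}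
  {Hu Hw : EuclideanSpace ℝ (Fin n) → Matrix (Fin n) (Fin n) ℝ}

theorem tendsto_setIntegral_det_mollifyMatrix (hconv : Convex ℝ Ω) (hopen : IsOpen Ω)
    (hbdd : Bornology.IsBounded Ω) (hu : IsW2InftyOn Ω u Hu) (hw : IsW2InftyOn univ w Hw)
    {η : ℕ → ContDiffBump (0 : EuclideanSpace ℝ (Fin n))}
    (hη : Tendsto (fun m => (η m).rOut) atTop (𝓝 0)) (h2 : ∀ m, (η m).rOut ≤ 2 * (η m).rIn)
    (h1 : ∀ m, (η m).rOut ≤ 1)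
    {r : ℕ → ℝ} (hr : Tendsto r atTop (𝓝 1)) (hr0 : ∀ m, 0 ≤ r m) (hr1 : ∀ m, r m ≤ 1)
    {R : ℝ} (hR : 0 < R) (hrη : ∀ m, (1 - r m) * R = 5 * (η m).rOut)
    (x₀ : EuclideanSpace ℝ (Fin n)) (t : ℝ) :
    Tendsto (fun m => ∫ x in closure (Metric.thickening (2 * (η m).rOut) Ω),
        (r m ^ 2 • mollifyMatrix (η m) Ω Hu (AffineMap.homothety x₀ (r m) x) +
          t • mollifyMatrix (η m) univ Hw x).det • x) atTop
      (𝓝 (∫ x in Ω, (Hu x + t • Hw x).det • x)) := by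
  obtain ⟨A, hA0, hA⟩ := hu.exists_ae_bound hopen
  obtain ⟨B, hB0, hB⟩ := hw.exists_ae_bound isOpen_univ
  have hsub : ∀ m, closure (Metric.thickening (2 * (η m).rOut) Ω) ⊆ Metric.cthickening 2 Ω :=
    fun m => (Metric.closure_thickening_subset_cthickening _ _).trans
      (Metric.cthickening_mono (by linarith [h1 m]) _)
  have hKb : Bornology.IsBounded (Metric.cthickening 2 Ω) := hbdd.cthickening
  obtain ⟨D, hD⟩ := hKb.exists_norm_le
  rw [← integral_indicator hopen.measurableSet]
  simp_rw [fun m => (integral_indicator (μ := (volume : Measure (EuclideanSpace ℝ (Fin n))))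
    (isClosed_closure (s := Metric.thickening (2 * (η m).rOut) Ω)).measurableSet
    (f := fun x => (r m ^ 2 • mollifyMatrix (η m) Ω Hu (AffineMap.homothety x₀ (r m) x) +
          t • mollifyMatrix (η m) univ Hw x).det • x)).symm]
  refine tendsto_integral_of_dominated_convergence
    ((Metric.cthickening 2 Ω).indicator fun _ => (n.factorial • (A + |t| * B) ^ n) * D) ?_ ?_ ?_ ?_
  · intro m
    refine AEStronglyMeasurable.indicator ?_ isClosed_closure.measurableSet
    have hc1 := hu.continuous_mollifyMatrix hopen (η m)
    have hc2 := hw.continuous_mollifyMatrix isOpen_univ (η m)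
    have hc3 : Continuous fun x => AffineMap.homothety x₀ (r m) x := by
      simp only [AffineMap.homothety_apply, vsub_eq_sub, vadd_eq_add]
      fun_prop
    have hc : Continuous fun x =>
        (r m ^ 2 • mollifyMatrix (η m) Ω Hu (AffineMap.homothety x₀ (r m) x) +
          t • mollifyMatrix (η m) univ Hw x).det • x :=
      ((((hc1.comp hc3).const_smul (r m ^ 2)).add (hc2.const_smul t)).matrix_det).smul
        continuous_id
    exact hc.aestronglyMeasurable
  · rw [integrable_indicator_iff Metric.isClosed_cthickening.measurableSet]
    exact integrableOn_const hKb.measure_lt_top.ne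
  · refine fun m => Eventually.of_forall fun x => ?_
    by_cases hx : x ∈ closure (Metric.thickening (2 * (η m).rOut) Ω)
    · rw [indicator_of_mem hx, indicator_of_mem (hsub m hx), norm_smul, Real.norm_eq_abs]
      refine mul_le_mul (abs_det_le fun i j => ?_) (hD x (hsub m hx)) (norm_nonneg _)
        (by positivity)
      rw [Matrix.add_apply, Matrix.smul_apply, Matrix.smul_apply, smul_eq_mul, smul_eq_mul]
      refine (abs_add_le _ _).trans (add_le_add ?_ ?_)
      · rw [abs_mul, abs_of_nonneg (by positivity)]
        calc _ ≤ 1 * A := mul_le_mul (pow_le_one₀ (hr0 m) (hr1 m))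
              (abs_mollify_le (η m) (hA i j) _) (abs_nonneg _) zero_le_one
          _ = A := one_mul A
      · rw [abs_mul]
        exact mul_le_mul_of_nonneg_left (abs_mollify_le (η m) (hB i j) _) (abs_nonneg t)
    · rw [indicator_of_notMem hx, norm_zero]
      refine indicator_nonneg (fun x hx => ?_) x
      have := (norm_nonneg x).trans (hD x hx)
      positivity
  · have hcu : ∀ᵐ x, ∀ i j, ∀ (c : ℕ → EuclideanSpace ℝ (Fin n)) (K : ℝ),
        (∀ m, dist x (c m) ≤ K * (η m).rOut) →
        Tendsto (fun m => mollify (η m) (Ω.indicator fun y => Hu y i j) (c m)) atTop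
          (𝓝 (Ω.indicator (fun y => Hu y i j) x)) := by
      obtain ⟨_, G, _, hH⟩ := hu
      exact ae_all_iff.2 fun i => ae_all_iff.2 fun j =>
        ae_tendsto_mollify (MemLp.locallyIntegrable_indicator hopen (hH i j).1) hη h2
    have hcw : ∀ᵐ x, ∀ i j, ∀ (c : ℕ → EuclideanSpace ℝ (Fin n)) (K : ℝ),
        (∀ m, dist x (c m) ≤ K * (η m).rOut) →
        Tendsto (fun m => mollify (η m) (univ.indicator fun y => Hw y i j) (c m)) atTop
          (𝓝 (univ.indicator (fun y => Hw y i j) x)) := by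
      obtain ⟨_, G, _, hH⟩ := hw
      exact ae_all_iff.2 fun i => ae_all_iff.2 fun j =>
        ae_tendsto_mollify (MemLp.locallyIntegrable_indicator isOpen_univ (hH i j).1) hη h2
    -- The boundary of a convex set is null, so it suffices to treat points of Ω and points at
    -- positive distance from it.
    have hfr : ∀ᵐ x, x ∉ frontier Ω :=
      measure_eq_zero_iff_ae_notMem.1 (hconv.addHaar_frontier volume)
    filter_upwards [hcu, hcw, hfr] with x hxu hxw hxf
    by_cases hx : x ∈ Ω
    · rw [indicator_of_mem hx]
      have hmem : ∀ m, x ∈ closure (Metric.thickening (2 * (η m).rOut) Ω) := fun m =>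
        subset_closure (Metric.self_subset_thickening (by linarith [(η m).rOut_pos]) _ hx)
      refine Tendsto.congr (fun m => (indicator_of_mem (hmem m) _).symm) (Tendsto.smul_const ?_ x)
      have hM : Tendsto (fun m =>
          r m ^ 2 • mollifyMatrix (η m) Ω Hu (AffineMap.homothety x₀ (r m) x) +
          t • mollifyMatrix (η m) univ Hw x) atTop (𝓝 (Hu x + t • Hw x)) := by
        refine tendsto_pi_nhds.2 fun i => tendsto_pi_nhds.2 fun j => ?_
        -- The homothety moves x by (1 - r)‖x - x₀‖, a fixed multiple of the mollification radius,
        -- so the off-centre convergence applies.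
        have e1 := hxu i j (fun m => AffineMap.homothety x₀ (r m) x) (5 / R * dist x₀ x) fun m => by
          rw [dist_self_homothety, Real.norm_eq_abs, abs_of_nonneg (by linarith [hr1 m])]
          have : 1 - r m = 5 / R * (η m).rOut := by
            rw [div_mul_eq_mul_div, eq_div_iff hR.ne', hrη m]
          rw [this]
          exact le_of_eq (by ring)
        have e2 := hxw i j (fun _ => x) 0 fun m => by simp
        rw [indicator_of_mem hx] at e1
        rw [indicator_of_mem (mem_univ x)] at e2
        have e3 := ((hr.pow 2).mul e1).add (e2.const_mul t)
        rw [one_pow, one_mul] at e3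
        exact e3
      exact (continuous_id.matrix_det.tendsto _).comp hM
    · rw [indicator_of_notMem hx]
      have hxc : x ∉ closure Ω := fun h => hxf ⟨h, fun h' => hx (interior_subset h')⟩
      rw [Metric.closure_eq_iInter_cthickening] at hxc
      simp only [mem_iInter, not_forall] at hxc
      obtain ⟨δ, hδ, hxδ⟩ := hxc
      refine tendsto_const_nhds.congr' ?_
      have hη2 : Tendsto (fun m => 2 * (η m).rOut) atTop (𝓝 0) := by
        simpa using hη.const_mul 2
      filter_upwards [hη2.eventually_lt_const hδ] with m hm
      rw [indicator_of_notMem]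
      exact fun h => hxδ (Metric.cthickening_mono hm.le _
        (Metric.closure_thickening_subset_cthickening _ _ h))

/-- The smooth identity is applied on a thickening of Ω that contains the support of the mollified
w. The homothety makes the mollified Hessian of u available on all of that thickening; the factor r²
is from the chain rule. -/
theorem setIntegral_det_mollifyMatrix_eq (hconv : Convex ℝ Ω) (hopen : IsOpen Ω)
    (hbdd : Bornology.IsBounded Ω) (hu : IsW2InftyOn Ω u Hu) (hw : IsW2InftyOn univ w Hw)
    (hw0 : ∀ᵐ x, x ∉ Ω → w x = 0)
    (η : ContDiffBump (0 : EuclideanSpace ℝ (Fin n))) {r R : ℝ} (hr0 : 0 < r) (hr1 : r < 1)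
    (hrη : (1 - r) * R = 5 * η.rOut) {x₀ : EuclideanSpace ℝ (Fin n)}
    (hball : Metric.ball x₀ R ⊆ Ω) (t : ℝ) :
    ∫ x in closure (Metric.thickening (2 * η.rOut) Ω),
        (r ^ 2 • mollifyMatrix η Ω Hu (AffineMap.homothety x₀ r x) +
          t • mollifyMatrix η univ Hw x).det • x =
      ∫ x in closure (Metric.thickening (2 * η.rOut) Ω),
        (r ^ 2 • mollifyMatrix η Ω Hu (AffineMap.homothety x₀ r x)).det • x := by
  have hpos := η.rOut_pos
  have hTb : Bornology.IsBounded (Metric.thickening (2 * η.rOut) Ω) := hbdd.thickening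
  obtain ⟨ρ, hρ⟩ := hTb.subset_closedBall x₀
  set V := mollify η (Ω.indicator u)
  set W := mollify η (univ.indicator w)
  have hV : ContDiff ℝ ∞ V := contDiff_mollify η (MemLp.locallyIntegrable_indicator hopen hu.1)
  have hW : ContDiff ℝ ∞ W :=
    contDiff_mollify η (MemLp.locallyIntegrable_indicator isOpen_univ hw.1)
  have hV0 : ∀ x ∉ Metric.thickening (2 * η.rOut) Ω, V x = 0 := fun x hx =>
    mollify_eq_zero η (Eventually.of_forall fun y hy => indicator_of_notMem hy _) (by linarith) hx
  have hW0 : ∀ x ∉ Metric.thickening (2 * η.rOut) Ω, W x = 0 := fun x hx =>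
    mollify_eq_zero η (by rwa [indicator_univ]) (by linarith) hx
  have hWs : HasCompactSupport W := HasCompactSupport.intro (isCompact_closedBall x₀ ρ)
    fun x hx => hW0 x fun h => hx (hρ h)
  have hVs : HasCompactSupport fun x => V (AffineMap.homothety x₀ r x) :=
    hasCompactSupport_comp_homothety (R := ρ) hr0 fun x hx => hV0 x fun h =>
      hx.not_ge (hρ h)
  have hVd : ContDiff ℝ ∞ fun x => V (AffineMap.homothety x₀ r x) :=
    contDiff_comp_homothety hV x₀ r
  have htW : ContDiff ℝ ∞ (t • W) := hW.const_smul t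
  have key := setIntegral_det_hessian_add Metric.isOpen_thickening hTb hVd hVs htW
    (hWs.smul_left (f := fun _ => t))
    (fun x hx => by rw [Pi.smul_apply, hW0 x hx, smul_zero])
  have hHV : ∀ x ∈ closure (Metric.thickening (2 * η.rOut) Ω),
      hessian (fun x => V (AffineMap.homothety x₀ r x)) x =
        r ^ 2 • mollifyMatrix η Ω Hu (AffineMap.homothety x₀ r x) := by
    intro x hx
    rw [hessian_comp_homothety hV, hu.hessian_mollify hopen η (r := 2 * η.rOut) (by linarith)]
    -- This is where the 5 comes from: a ball of radius 2 `rOut` around the image of a point of the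
    -- 3 `rOut`-thickening.
    exact closedBall_homothety_subset hconv hball hr0.le hr1 (δ := 3 * η.rOut) (by linarith)
      (Metric.cthickening_subset_thickening' (by linarith) (by linarith) _
        (Metric.closure_thickening_subset_cthickening _ _ hx))
  have hHW : ∀ x, hessian W x = mollifyMatrix η univ Hw x := fun x =>
    hw.hessian_mollify isOpen_univ η (lt_add_one _) (subset_univ _)
  have hmeas : MeasurableSet (closure (Metric.thickening (2 * η.rOut) Ω)) :=
    isClosed_closure.measurableSet
  rw [setIntegral_congr_fun hmeas fun x hx => ?_, key, setIntegral_congr_fun hmeas fun x hx => ?_]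
  · rw [hHV x hx]
  · rw [hessian_add hVd htW, hessian_const_smul hW, hHV x hx, hHW]

/-- The first moment of the determinant of the weak Hessian is a null Lagrangian. -/
theorem setIntegral_det_weakHessian_eq (hconv : Convex ℝ Ω) (hopen : IsOpen Ω)
    (hbdd : Bornology.IsBounded Ω) (hu : IsW2InftyOn Ω u Hu) (hw : IsW2InftyZeroOn Ω w Hw)
    (t : ℝ) : ∫ x in Ω, (Hu x + t • Hw x).det • x = ∫ x in Ω, (Hu x).det • x := by
  rcases Ω.eq_empty_or_nonempty with rfl | ⟨x₀, hx₀⟩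
  · simp
  obtain ⟨R₀, hR₀, hball₀⟩ := Metric.isOpen_iff.1 hopen x₀ hx₀
  set R := min R₀ 1
  have hR : 0 < R := lt_min hR₀ one_pos
  have hball : Metric.ball x₀ R ⊆ Ω := (Metric.ball_subset_ball (min_le_left _ _)).trans hball₀
  have hs : ∀ m : ℕ, 0 < 1 / ((m : ℝ) + 1) ∧ 1 / ((m : ℝ) + 1) ≤ 1 := fun m =>
    ⟨Nat.one_div_pos_of_nat, by
      rw [div_le_one (by positivity)]
      linarith [Nat.cast_nonneg (α := ℝ) m]⟩
  have hs0 : Tendsto (fun m : ℕ => 1 / ((m : ℝ) + 1)) atTop (𝓝 0) :=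
    tendsto_one_div_add_atTop_nhds_zero_nat
  set s : ℕ → ℝ := fun m => 1 / ((m : ℝ) + 1)
  have hpos : ∀ m, 0 < R / 10 * s m := fun m => mul_pos (by positivity) (hs m).1
  -- The radius R s/10 and the ratio 1 - s/2 are matched so that (1 - r) R = 5 `rOut`; R ≤ 1 keeps
  -- the radii at most 1.
  let η : ℕ → ContDiffBump (0 : EuclideanSpace ℝ (Fin n)) := fun m =>
    ⟨R / 10 * s m / 2, R / 10 * s m, half_pos (hpos m), half_lt_self (hpos m)⟩
  let r : ℕ → ℝ := fun m => 1 - s m / 2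
  have hη : Tendsto (fun m => (η m).rOut) atTop (𝓝 0) := by
    simpa using hs0.const_mul (R / 10)
  have hr : Tendsto r atTop (𝓝 1) := by
    simpa using (hs0.div_const 2).const_sub 1
  have hrη : ∀ m, (1 - r m) * R = 5 * (η m).rOut := fun m => by
    simp only [r, η]
    ring
  have h1 : ∀ m, (η m).rOut ≤ 1 := fun m => by
    have : R ≤ 1 := min_le_right _ _
    simp only [η]
    nlinarith [(hs m).1, (hs m).2]
  have h2 : ∀ m, (η m).rOut ≤ 2 * (η m).rIn := fun m => by
    simp only [η]
    linarith
  have hr0 : ∀ m, 0 < r m := fun m => by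
    simp only [r]
    linarith [(hs m).2]
  have hr1 : ∀ m, r m < 1 := fun m => by
    simp only [r]
    linarith [(hs m).1]
  have hlim := tendsto_setIntegral_det_mollifyMatrix hconv hopen hbdd hu hw.1 hη h2 h1 hr
    (fun m => (hr0 m).le) (fun m => (hr1 m).le) hR hrη x₀
  have hlim0 := hlim 0
  simp only [zero_smul, add_zero] at hlim0
  -- The approximating integrals for t and for 0 coincide at every stage, so their limits do.
  refine tendsto_nhds_unique (hlim t) (hlim0.congr fun m => ?_)
  exact (setIntegral_det_mollifyMatrix_eq hconv hopen hbdd hu hw.1 hw.2 (η m) (hr0 m) (hr1 m)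
    (hrη m) hball t).symm

theorem integrableOn_det_smul {U : Set (EuclideanSpace ℝ (Fin n))} (hopen : IsOpen Ω)
    (hU : IsOpen U) (hΩU : Ω ⊆ U) (hbdd : Bornology.IsBounded Ω) (hu : IsW2InftyOn Ω u Hu)
    (hw : IsW2InftyOn U w Hw) (t : ℝ) :
    IntegrableOn (fun x => (Hu x + t • Hw x).det • x) Ω := by
  obtain ⟨A, hA0, hA⟩ := hu.exists_ae_bound hopen
  obtain ⟨B, hB0, hB⟩ := hw.exists_ae_bound hU
  obtain ⟨D, hD⟩ := hbdd.exists_norm_le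
  have hm : AEMeasurable (fun x i j => Hu x i j + t * Hw x i j) (volume.restrict Ω) :=
    aemeasurable_pi_iff.2 fun i => aemeasurable_pi_iff.2 fun j =>
      (hu.aemeasurable i j).add
        (((hw.aemeasurable i j).mono_measure (Measure.restrict_mono hΩU le_rfl)).const_mul t)
  have hdet : Continuous fun M : Fin n → Fin n → ℝ => (Matrix.of M).det :=
    Continuous.matrix_det (continuous_id (X := Matrix (Fin n) (Fin n) ℝ))
  have : IsFiniteMeasure (volume.restrict Ω) := ⟨by simpa using hbdd.measure_lt_top⟩
  refine Integrable.of_bound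
    (AEStronglyMeasurable.smul (hdet.measurable.comp_aemeasurable hm).aestronglyMeasurable
      measurable_id.aestronglyMeasurable) ((n.factorial • (A + |t| * B) ^ n) * D) ?_
  rw [ae_restrict_iff' hopen.measurableSet]
  filter_upwards [ae_all_iff.2 fun i => ae_all_iff.2 (hA i),
    ae_all_iff.2 fun i => ae_all_iff.2 (hB i)] with x hxA hxB hx
  rw [norm_smul, Real.norm_eq_abs]
  refine mul_le_mul (abs_det_le fun i j => ?_) (hD x hx) (norm_nonneg _) (by positivity)
  have hAx := hxA i j
  have hBx := hxB i j
  rw [indicator_of_mem hx] at hAx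
  rw [indicator_of_mem (hΩU hx)] at hBx
  rw [Matrix.add_apply, Matrix.smul_apply, smul_eq_mul]
  refine (abs_add_le _ _).trans (add_le_add hAx ?_)
  rw [abs_mul]
  exact mul_le_mul_of_nonneg_left hBx (abs_nonneg t)

end NullLagrangian

theorem lemma2p3 {n : ℕ} (Ω : Set (EuclideanSpace ℝ (Fin n)))
    (hconv : Convex ℝ Ω) (hopen : IsOpen Ω) (hbdd : Bornology.IsBounded Ω) :
    (∀ (u v : EuclideanSpace ℝ (Fin n) → ℝ) (hu : Continuous u) (hv : Continuous v),
      ConvexOn ℝ Set.univ u → ConvexOn ℝ Set.univ v → (∀ x, x ∉ Ω → u x = v x) →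
        subgradientImage u (closure Ω) = subgradientImage v (closure Ω) ∧
        mongeAmpere u hu (closure Ω) = mongeAmpere v hv (closure Ω) ∧
        mongeAmpere u hu (closure Ω) < ⊤ ∧
        IntegrableOn (fun x => x) (closure Ω) (mongeAmpere u hu) ∧
        IntegrableOn (fun x => x) (closure Ω) (mongeAmpere v hv) ∧
        ∫ x in closure Ω, x ∂(mongeAmpere u hu) = ∫ x in closure Ω, x ∂(mongeAmpere v hv)) ∧
    (∀ (u w : EuclideanSpace ℝ (Fin n) → ℝ)
      (Hu Hw : EuclideanSpace ℝ (Fin n) → Matrix (Fin n) (Fin n) ℝ),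
      IsW2InftyOn Ω u Hu → IsW2InftyZeroOn Ω w Hw →
        (∀ t : ℝ, IntegrableOn (fun x => (Hu x + t • Hw x).det • x) Ω) ∧
        (∀ t : ℝ, ∫ x in Ω, (Hu x + t • Hw x).det • x = ∫ x in Ω, (Hu x).det • x) ∧
        HasDerivAt (fun t : ℝ => ∫ x in Ω, (Hu x + t • Hw x).det • x) 0 0) := by
  refine ⟨fun u v hu hv huc hvc huv => ?_, fun u w Hu Hw hu hw => ⟨fun t => ?_, fun t => ?_, ?_⟩⟩
  · have hK := hbdd.isCompact_closure
    have himg := subgradientImage_closure_eq hopen hbdd hu hv huc hvc huv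
    refine ⟨himg, ?_, mongeAmpere_lt_top hu hK, integrableOn_id_mongeAmpere hu hK,
      integrableOn_id_mongeAmpere hv hK, setIntegral_id_mongeAmpere_eq hopen hbdd hu hv huc hvc huv⟩
    rw [mongeAmpere_apply hu hK.measurableSet, mongeAmpere_apply hv hK.measurableSet, himg]
  · exact integrableOn_det_smul hopen isOpen_univ (subset_univ Ω) hbdd hu hw.1 t
  · exact setIntegral_det_weakHessian_eq hconv hopen hbdd hu hw t
  · simp_rw [setIntegral_det_weakHessian_eq hconv hopen hbdd hu hw]
    exact hasDerivAt_const 0 _
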